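/- Let $R$ be a commutative ring with $1$. For $a_1,\dots,a_n\in R$ let $J(a_1,\dots,a_n)$ be the intersection of all maximal ideals of $R$ containing $a_1,\dots,a_n$ (equal to $R$ if there are none). Suppose that $R$ satisfies the absolute stable range condition $\mathrm{ASR}_3$: for all $a_1,a_2,a_3\in R$ there are $b_1,b_2\in R$ with $J(a_1+a_3b_1,\,a_2+a_3b_2)=J(a_1,a_2,a_3)$. Let $G(\mathrm G_2,R)$ be the Chevalley group of type $\mathrm G_2$ over $R$, i.e. the group of $R$-points of the Chevalley–Demazure group scheme of type $\mathrm G_2$, realised in its $7$-dimensional short root representation. Let $x_\alpha(\xi)$, for $\alpha$ one of the $12$ roots and $\xi\in R$, be its elementary root unipotents, and for $L\ge 0$ let $E^L(\mathrm G_2,R)$ be the set of all products of at most $L$ elements $x_\alpha(\xi)$. Let $G(\mathrm A_2,R)\le G(\mathrm G_2,R)$ be the image of $\mathrm{SL}_3(R)$ under the embedding $\mathrm A_2\subset\mathrm G_2$ onto the long roots, and let $G(\mathrm A_1,R)\le G(\mathrm A_2,R)$ be the image of $\mathrm{SL}_2(R)$ under the embedding $\mathrm A_1=\{\pm\delta\}\subset\mathrm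 A_2$, where $\delta$ is any long root. Then $$ G(\mathrm G_2,R)=G(\mathrm A_1,R)\,E^{24}(\mathrm G_2,R)=G(\mathrm A_2,R)\,E^{24}(\mathrm G_2,R), $$ where the products are products of subsets of $G(\mathrm G_2,R)$. -/

import Mathlib

open scoped Pointwise

noncomputable section

namespace ChevalleyG2

/-! ## The absolute stable range condition -/

/-- `J(a)`: the intersection of the maximal ideals of `R` containing all entries of the row `a`
(equal to `R` if there are none). -/
def rowRadical {R : Type*} [CommRing R] {n : ℕ} (a : Fin n → R) : Ideal R :=
  sInf {M : Ideal R | M.IsMaximal ∧ ∀ i, a i ∈ M}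

/-- The absolute stable range condition `ASR_m`, where `m = n + 1 ≥ 1`: for every row
`(a_1, …, a_{n+1})` there are `b_1, …, b_n` with
`J(a_1 + a_{n+1} b_1, …, a_n + a_{n+1} b_n) = J(a_1, …, a_{n+1})`. -/
def ASR (R : Type*) [CommRing R] (m : ℕ) : Prop :=
  ∀ n : ℕ, n + 1 = m → ∀ a : Fin (n + 1) → R, ∃ b : Fin n → R,
    rowRadical (fun i : Fin n => a i.castSucc + a (Fin.last n) * b i) = rowRadical a

/-! ## Schematic closure over `ℤ` of a group of rational matrices -/

section Closure

variable {n : Type*} [Fintype n] [DecidableEq n]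

/-- Representatives of the regular functions on the group scheme `GL_n` over `ℤ`: polynomials in
the entries of `g` (variables `Sum.inl (i, j)`) and of `g⁻¹` (variables `Sum.inr (i, j)`). -/
abbrev RegFun (n : Type*) : Type _ := MvPolynomial ((n × n) ⊕ (n × n)) ℤ

/-- The entries of `g` and of `g⁻¹`. -/
def coords {R : Type*} [CommRing R] (g : GL n R) : (n × n) ⊕ (n × n) → R :=
  Sum.elim (fun p => (g : Matrix n n R) p.1 p.2)
    (fun p => ((g⁻¹ : GL n R) : Matrix n n R) p.1 p.2)

/-- The value of a regular function at `g ∈ GL_n(R)`. -/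
def evalAt {R : Type*} [CommRing R] (g : GL n R) : RegFun n →ₐ[ℤ] R :=
  MvPolynomial.aeval (coords g)

/-- The ideal of the regular functions over `ℤ` on `GL_n` that vanish on `Γ ≤ GL_n(ℚ)`. -/
def vanishingIdeal (Γ : Subgroup (GL n ℚ)) : Ideal (RegFun n) where
  carrier := {f | ∀ x ∈ Γ, evalAt x f = 0}
  zero_mem' := fun x _ => map_zero _
  add_mem' := fun hf hg x hx => by rw [map_add, hf x hx, hg x hx, add_zero]
  smul_mem' := fun c f hf x hx => by rw [smul_eq_mul, map_mul, hf x hx, mul_zero]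

lemma mem_vanishingIdeal {Γ : Subgroup (GL n ℚ)} {f : RegFun n} :
    f ∈ vanishingIdeal Γ ↔ ∀ x ∈ Γ, evalAt x f = 0 := Iff.rfl

/-- The antipode on `RegFun n`. -/
lemma evalAt_inv {R : Type*} [CommRing R] (g : GL n R) (f : RegFun n) :
    evalAt g⁻¹ f = evalAt g (MvPolynomial.rename Sum.swap f) := by
  simp only [evalAt, MvPolynomial.aeval_rename]
  congr 1
  congr 1
  funext p
  rcases p with p | p <;> simp [coords]

open TensorProduct in
/-- The comultiplication on `RegFun n`. -/
def comul : RegFun n →ₐ[ℤ] RegFun n ⊗[ℤ] RegFun n :=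
  MvPolynomial.aeval (Sum.elim
    (fun p => ∑ k, MvPolynomial.X (Sum.inl (p.1, k)) ⊗ₜ MvPolynomial.X (Sum.inl (k, p.2)))
    (fun p => ∑ k, MvPolynomial.X (Sum.inr (k, p.2)) ⊗ₜ MvPolynomial.X (Sum.inr (p.1, k))))

lemma evalAt_mul {R : Type*} [CommRing R] (g h : GL n R) (f : RegFun n) :
    evalAt (g * h) f = Algebra.TensorProduct.productMap (evalAt g) (evalAt h) (comul f) := by
  have : evalAt (g * h) =
      (Algebra.TensorProduct.productMap (evalAt g) (evalAt h)).comp comul := by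
    apply MvPolynomial.algHom_ext
    rintro (⟨i, j⟩ | ⟨i, j⟩)
    · simp [evalAt, comul, coords, Matrix.mul_apply]
    · simp only [evalAt, comul, coords, mul_inv_rev, AlgHom.comp_apply, MvPolynomial.aeval_X,
        Sum.elim_inr, Units.val_mul, Matrix.mul_apply, map_sum,
        Algebra.TensorProduct.productMap_apply_tmul]
      exact Finset.sum_congr rfl fun k _ => mul_comm _ _
  rw [this]; rfl

open TensorProduct in
lemma exists_comul (I : Ideal (RegFun n)) [Module.IsTorsionFree ℤ (RegFun n ⧸ I)]
    (f : RegFun n) : ∃ (m : ℕ) (c : Fin m → RegFun n) (b : Fin m → RegFun n ⧸ I),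
      LinearIndependent ℤ b ∧
      Algebra.TensorProduct.map (AlgHom.id ℤ (RegFun n)) (Ideal.Quotient.mkₐ ℤ I) (comul f) =
        ∑ k, c k ⊗ₜ[ℤ] b k := by
  classical
  obtain ⟨s, hs⟩ := TensorProduct.exists_finset (comul f)
  let S : Submodule ℤ (RegFun n ⧸ I) :=
    Submodule.span ℤ ((s.image fun p => Ideal.Quotient.mk I p.2 : Finset _) : Set (RegFun n ⧸ I))
  have : Module.Finite ℤ S := Module.Finite.span_finset ℤ _
  let B := Module.finBasis ℤ S
  have hmem : ∀ p ∈ s, Ideal.Quotient.mk I p.2 ∈ S := fun p hp =>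
    Submodule.subset_span (by simpa using ⟨p.1, p.2, hp, rfl⟩)
  refine ⟨_, fun k => ∑ p ∈ s.attach, B.repr ⟨_, hmem p.1 p.2⟩ k • p.1.1, fun k => (B k : _),
    B.linearIndependent.map' S.subtype (Submodule.ker_subtype S), ?_⟩
  rw [hs, map_sum, ← Finset.sum_attach]
  simp only [TensorProduct.sum_tmul, TensorProduct.smul_tmul]
  rw [Finset.sum_comm]
  refine Finset.sum_congr rfl fun p _ => ?_
  rw [← TensorProduct.tmul_sum, Algebra.TensorProduct.map_tmul]
  have h := congrArg (Submodule.subtype S) (B.sum_repr ⟨_, hmem p.1 p.2⟩)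
  rw [map_sum] at h
  simp only [map_smul, Submodule.subtype_apply] at h
  rw [h]
  rfl

lemma evalAt_mul_of_comul (I : Ideal (RegFun n)) {R : Type*} [CommRing R] (x y : GL n R)
    (hy : ∀ f ∈ I, evalAt y f = 0) (f : RegFun n) {m : ℕ} (c : Fin m → RegFun n)
    (b : Fin m → RegFun n ⧸ I)
    (h : Algebra.TensorProduct.map (AlgHom.id ℤ (RegFun n)) (Ideal.Quotient.mkₐ ℤ I) (comul f) =
        ∑ k, c k ⊗ₜ[ℤ] b k) :
    evalAt (x * y) f = ∑ k, evalAt x (c k) * Ideal.Quotient.liftₐ I (evalAt y) hy (b k) := by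
  have h' := congrArg
    (Algebra.TensorProduct.productMap (evalAt x) (Ideal.Quotient.liftₐ I (evalAt y) hy)) h
  rw [map_sum] at h'
  simp only [Algebra.TensorProduct.productMap_apply_tmul] at h'
  have hcomp : Algebra.TensorProduct.productMap (evalAt x) (evalAt y) =
      (Algebra.TensorProduct.productMap (evalAt x) (Ideal.Quotient.liftₐ I (evalAt y) hy)).comp
        (Algebra.TensorProduct.map (AlgHom.id ℤ (RegFun n)) (Ideal.Quotient.mkₐ ℤ I)) := by
    apply Algebra.TensorProduct.ext'
    intro u v
    simp only [AlgHom.comp_apply, Algebra.TensorProduct.map_tmul,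
      Algebra.TensorProduct.productMap_apply_tmul, AlgHom.id_apply]
    rfl
  rw [← h', evalAt_mul, hcomp, AlgHom.comp_apply]

/-- The schematic closure over `ℤ` of `Γ ≤ GL_n(ℚ)` is stable under multiplication. -/
lemma evalAt_mul_eq_zero (Γ : Subgroup (GL n ℚ)) {R : Type*} [CommRing R] (g h : GL n R)
    (hg : ∀ f ∈ vanishingIdeal Γ, evalAt g f = 0) (hh : ∀ f ∈ vanishingIdeal Γ, evalAt h f = 0)
    (f : RegFun n) (hf : f ∈ vanishingIdeal Γ) : evalAt (g * h) f = 0 := by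
  set I := vanishingIdeal Γ with hI
  have hΓ : ∀ y ∈ Γ, ∀ f ∈ I, evalAt y f = 0 := fun y hy f hf => hf y hy
  have hinj : ∀ z : RegFun n ⧸ I,
      (∀ y (hy : y ∈ Γ), Ideal.Quotient.liftₐ I (evalAt y) (hΓ y hy) z = 0) → z = 0 := by
    intro z hz
    obtain ⟨z, rfl⟩ := Ideal.Quotient.mk_surjective z
    rw [Ideal.Quotient.eq_zero_iff_mem]
    exact fun y hy => hz y hy
  have : Module.IsTorsionFree ℤ (RegFun n ⧸ I) := by
    rw [Module.isTorsionFree_iff_smul_eq_zero]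
    intro r z hrz
    by_cases hr : r = 0
    · exact Or.inl hr
    · refine Or.inr (hinj z fun y hy => ?_)
      have := congrArg (Ideal.Quotient.liftₐ I (evalAt y) (hΓ y hy)) hrz
      rw [map_smul, map_zero, smul_eq_zero] at this
      exact this.resolve_left hr
  obtain ⟨m, c, b, hb, hcb⟩ := exists_comul I f
  rw [evalAt_mul_of_comul I g h hh f c b hcb]
  refine Finset.sum_eq_zero fun k _ => ?_
  rw [hg (c k), zero_mul]
  intro x hx
  obtain ⟨d, hd⟩ := IsLocalization.exist_integer_multiples_of_finite (nonZeroDivisors ℤ)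
    (fun k => evalAt x (c k))
  choose a ha using hd
  have hd0 : (d : ℤ) ≠ 0 := nonZeroDivisors.ne_zero d.2
  have hsum : ∑ k, a k • b k = 0 := by
    refine hinj _ fun y hy => ?_
    have h1 := hf (x * y) (Γ.mul_mem hx hy)
    rw [evalAt_mul_of_comul I x y (hΓ y hy) f c b hcb] at h1
    rw [map_sum]
    have h2 : ∀ k, Ideal.Quotient.liftₐ I (evalAt y) (hΓ y hy) (a k • b k) =
        (d : ℤ) • (evalAt x (c k) * Ideal.Quotient.liftₐ I (evalAt y) (hΓ y hy) (b k)) := by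
      intro k
      rw [map_smul, ← smul_mul_assoc, ← ha k, zsmul_eq_mul]
      rfl
    rw [Finset.sum_congr rfl fun k _ => h2 k, ← Finset.smul_sum, h1, smul_zero]
  have h0 := Fintype.linearIndependent_iff.1 hb a hsum k
  have h3 := ha k
  rw [h0, map_zero] at h3
  exact (smul_eq_zero.1 h3.symm).resolve_left hd0

/-- The group of `R`-points of the schematic closure over `ℤ` of `Γ ≤ GL_n(ℚ)` in the group scheme
`GL_n`: the `g ∈ GL_n(R)` at which every regular function with integer coefficients that vanishes
on `Γ` vanishes. -/
def schematicClosure (Γ : Subgroup (GL n ℚ)) (R : Type*) [CommRing R] : Subgroup (GL n R) where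
  carrier := {g | ∀ f ∈ vanishingIdeal Γ, evalAt g f = 0}
  one_mem' := by
    intro f hf
    have h1 : evalAt (1 : GL n R) f = ((evalAt (1 : GL n ℤ) f : ℤ) : R) := by
      have : evalAt (1 : GL n R) =
          (Algebra.ofId ℤ R).comp (evalAt (1 : GL n ℤ)) := by
        apply MvPolynomial.algHom_ext
        rintro (⟨i, j⟩ | ⟨i, j⟩) <;> by_cases hij : i = j <;>
          simp [evalAt, coords, hij, Matrix.one_apply]
      rw [this]; rfl
    have h2 : evalAt (1 : GL n ℚ) f = ((evalAt (1 : GL n ℤ) f : ℤ) : ℚ) := by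
      have : evalAt (1 : GL n ℚ) =
          (Algebra.ofId ℤ ℚ).comp (evalAt (1 : GL n ℤ)) := by
        apply MvPolynomial.algHom_ext
        rintro (⟨i, j⟩ | ⟨i, j⟩) <;> by_cases hij : i = j <;>
          simp [evalAt, coords, hij, Matrix.one_apply]
      rw [this]; rfl
    rw [hf 1 Γ.one_mem] at h2
    rw [h1, Int.cast_eq_zero.1 h2.symm, Int.cast_zero]
  mul_mem' := fun hg hh f hf => evalAt_mul_eq_zero Γ _ _ hg hh f hf
  inv_mem' := by
    intro g hg f hf
    rw [evalAt_inv]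
    exact hg _ fun x hx => by rw [← evalAt_inv]; exact hf _ (Γ.inv_mem hx)

end Closure

/-! ## Root elements in the 7-dimensional representation -/

/-- The weights of the 7-dimensional representation: `ε_0, ε_1, ε_2`, then `-ε_0, -ε_1, -ε_2`,
then `0`, where `ε_0 + ε_1 + ε_2 = 0`. -/
abbrev Weight : Type := Fin 3 ⊕ Fin 3 ⊕ Unit

namespace Weight

/-- The weight `ε_i`. -/
abbrev pos (i : Fin 3) : Weight := Sum.inl i

/-- The weight `-ε_i`. -/
abbrev neg (i : Fin 3) : Weight := Sum.inr (Sum.inl i)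

/-- The weight `0`. -/
abbrev zero : Weight := Sum.inr (Sum.inr ())

end Weight

/-- The twelve roots of `G_2`. -/
inductive Root : Type
  /-- The short root `ε_i`. -/
  | pos (i : Fin 3) : Root
  /-- The short root `-ε_i`. -/
  | neg (i : Fin 3) : Root
  /-- The long root `ε_i - ε_j`. -/
  | long (i j : Fin 3) (hij : i ≠ j) : Root

/-- The root vectors `e_α` of a Chevalley basis of the simple Lie algebra of type `G_2`, acting on
an admissible lattice (with a basis of weight vectors) of its 7-dimensional representation.
They satisfy `[e_α, e_{-α}] = h_α` (the coroot), `[e_α, e_β] = ± (p + 1) e_{α + β}` if `α + β` is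
a root, with `p` maximal such that `β - p α` is a root, and `[e_α, e_β] = 0` if `α + β` is neither
a root nor `0`. Indices are taken modulo 3. -/
def rootVector : Root → Matrix Weight Weight ℤ
  | .pos i => Matrix.single (.pos i) .zero 1 + Matrix.single .zero (.neg i) 2
      + Matrix.single (.neg (i + 2)) (.pos (i + 1)) 1
      - Matrix.single (.neg (i + 1)) (.pos (i + 2)) 1
  | .neg i => Matrix.single (.neg i) .zero 1 + Matrix.single .zero (.pos i) 2
      - Matrix.single (.pos (i + 2)) (.neg (i + 1)) 1
      + Matrix.single (.pos (i + 1)) (.neg (i + 2)) 1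
  | .long i j _ => Matrix.single (.pos i) (.pos j) 1 - Matrix.single (.neg j) (.neg i) 1

/-- The divided square `e_α² / 2`; it is integral, see `rootVector_mul_self`. -/
def rootVectorSq (α : Root) : Matrix Weight Weight ℤ :=
  (rootVector α * rootVector α).map (· / 2)

lemma rootVector_mul_self : ∀ α : Root, rootVector α * rootVector α = (2 : ℤ) • rootVectorSq α
  | .pos i => by revert i; decide +kernel
  | .neg i => by revert i; decide +kernel
  | .long i j h => by revert i j; decide +kernel

lemma rootVector_mul_sq : ∀ α : Root, rootVector α * rootVectorSq α = 0
  | .pos i => by revert i; decide +kernel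
  | .neg i => by revert i; decide +kernel
  | .long i j h => by revert i j; decide +kernel

lemma rootVectorSq_mul : ∀ α : Root, rootVectorSq α * rootVector α = 0
  | .pos i => by revert i; decide +kernel
  | .neg i => by revert i; decide +kernel
  | .long i j h => by revert i j; decide +kernel

lemma rootVectorSq_mul_self : ∀ α : Root, rootVectorSq α * rootVectorSq α = 0
  | .pos i => by revert i; decide +kernel
  | .neg i => by revert i; decide +kernel
  | .long i j h => by revert i j; decide +kernel

section Elementary

variable {R : Type*} [CommRing R]

/-- The matrix `exp (ξ e_α) = 1 + ξ e_α + ξ² (e_α² / 2)`; note that `e_α³ = 0`. -/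
def rootMatrix (α : Root) (ξ : R) : Matrix Weight Weight R :=
  1 + ξ • (rootVector α).map (Int.castRingHom R)
    + ξ ^ 2 • (rootVectorSq α).map (Int.castRingHom R)

lemma rootMatrix_zero (α : Root) : rootMatrix α (0 : R) = 1 := by
  simp [rootMatrix]

lemma rootMatrix_mul (α : Root) (ξ η : R) :
    rootMatrix α ξ * rootMatrix α η = rootMatrix α (ξ + η) := by
  have h1 := congrArg (fun M => M.map (Int.castRingHom R)) (rootVector_mul_self α)
  have h2 := congrArg (fun M => M.map (Int.castRingHom R)) (rootVector_mul_sq α)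
  have h3 := congrArg (fun M => M.map (Int.castRingHom R)) (rootVectorSq_mul α)
  have h4 := congrArg (fun M => M.map (Int.castRingHom R)) (rootVectorSq_mul_self α)
  simp only [Matrix.map_mul, Matrix.map_zero _ (map_zero (Int.castRingHom R))] at h1 h2 h3 h4
  have h5 : ((2 : ℤ) • rootVectorSq α).map (Int.castRingHom R) =
      (2 : R) • (rootVectorSq α).map (Int.castRingHom R) := by
    ext a b
    simp only [Matrix.map_apply, Matrix.smul_apply, smul_eq_mul, map_mul, map_ofNat]
  rw [h5] at h1
  simp only [rootMatrix, mul_add, add_mul, one_mul, mul_one, Matrix.smul_mul, Matrix.mul_smul,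
    h1, h2, h3, h4, smul_zero, add_zero]
  module

/-- The root unipotent `x_α(ξ)`, an invertible matrix with inverse `x_α(-ξ)`. -/
def rootElement (α : Root) (ξ : R) : GL Weight R where
  val := rootMatrix α ξ
  inv := rootMatrix α (-ξ)
  val_inv := by rw [rootMatrix_mul, add_neg_cancel, rootMatrix_zero]
  inv_val := by rw [rootMatrix_mul, neg_add_cancel, rootMatrix_zero]

variable (R)

/-- The set of all root unipotents `x_α(ξ)`. -/
def rootElements : Set (GL Weight R) := {g | ∃ (α : Root) (ξ : R), g = rootElement α ξ}

/-- The elementary subgroup `E(G_2, R)`, generated by the root unipotents. -/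
def elementaryGroup : Subgroup (GL Weight R) := Subgroup.closure (rootElements R)

/-- The set `E^L(G_2, R)` of all products of at most `L` root unipotents. -/
def elementaryProducts (L : ℕ) : Set (GL Weight R) :=
  {g | ∃ l : List (GL Weight R), l.length ≤ L ∧ (∀ x ∈ l, x ∈ rootElements R) ∧ l.prod = g}

/-! ## The Chevalley groups -/

/-- The Chevalley group `G(G_2, R)`: the group of `R`-points of the Chevalley–Demazure group scheme
of type `G_2`, which is the schematic closure over `ℤ` of the Chevalley group over `ℚ` in the
general linear group of an admissible lattice. (The Chevalley group over the field `ℚ` is generated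
by its root unipotents.) -/
def groupG2 : Subgroup (GL Weight R) := schematicClosure (elementaryGroup ℚ) R

variable {R}

/-- `SL_3(R) → GL_7(R)`, `g ↦ diag(g, (gᵀ)⁻¹, 1)`, as a map to matrices. -/
def embA2Matrix : Matrix.SpecialLinearGroup (Fin 3) R →* Matrix Weight Weight R where
  toFun g := Matrix.fromBlocks g.1 0 0 (Matrix.fromBlocks (g⁻¹).1.transpose 0 0 1)
  map_one' := by simp
  map_mul' g h := by
    simp [Matrix.fromBlocks_multiply, Matrix.SpecialLinearGroup.coe_mul, Matrix.transpose_mul]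

/-- The homomorphism `G(A_2, R) = SL_3(R) → GL_7(R)`, `g ↦ diag(g, (gᵀ)⁻¹, 1)` induced by the
embedding of the long roots: it maps the elementary transvection `1 + ξ E_{ij}` to `x_α(ξ)`, where
`α = ε_i - ε_j`. -/
def embA2 : Matrix.SpecialLinearGroup (Fin 3) R →* GL Weight R := embA2Matrix.toHomUnits

/-- The `3 × 3` matrix with the entries of the `2 × 2` matrix `A` in the rows and columns `i, j`,
and with the entries of the identity matrix elsewhere. -/
def blockMatrix (i j : Fin 3) (A : Matrix (Fin 2) (Fin 2) R) : Matrix (Fin 3) (Fin 3) R :=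
  1 + Matrix.single i i (A 0 0 - 1) + Matrix.single i j (A 0 1)
    + Matrix.single j i (A 1 0) + Matrix.single j j (A 1 1 - 1)

lemma det_blockMatrix {i j : Fin 3} (hij : i ≠ j) (A : Matrix (Fin 2) (Fin 2) R) :
    (blockMatrix i j A).det = A.det := by
  rw [Matrix.det_fin_two, Matrix.det_fin_three]
  fin_cases i <;> fin_cases j <;> simp_all [blockMatrix] <;> ring

lemma blockMatrix_mul {i j : Fin 3} (hij : i ≠ j) (A B : Matrix (Fin 2) (Fin 2) R) :
    blockMatrix i j (A * B) = blockMatrix i j A * blockMatrix i j B := by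
  have hji := hij.symm
  simp only [blockMatrix, Matrix.mul_apply, Fin.sum_univ_two, mul_add,
    add_mul, one_mul, mul_one, Matrix.single_mul_single_same, add_zero,
    Matrix.single_mul_single_of_ne _ _ _ _ hij, Matrix.single_mul_single_of_ne _ _ _ _ hji]
  ext a b
  simp only [Matrix.add_apply, Matrix.single_apply]
  split_ifs <;> ring

/-- The homomorphism `SL_2(R) → SL_3(R)` that puts a `2 × 2` matrix in the rows and columns
`i, j`. -/
def embSL2 (i j : Fin 3) (hij : i ≠ j) :
    Matrix.SpecialLinearGroup (Fin 2) R →* Matrix.SpecialLinearGroup (Fin 3) R where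
  toFun g := ⟨blockMatrix i j g.1, by rw [det_blockMatrix hij, g.2]⟩
  map_one' := by
    apply Subtype.ext
    simp [blockMatrix]
  map_mul' g h := by
    apply Subtype.ext
    exact blockMatrix_mul hij g.1 h.1

variable (R)

/-- The subgroup `G(A_2, R)` of `G(G_2, R)`: the image of `SL_3(R)` under the long root
embedding. -/
def groupA2 : Subgroup (GL Weight R) := (embA2 (R := R)).range

/-- The subgroup `G(A_1, R)` of `G(A_2, R)`: the image of `SL_2(R)` under the embedding on the long
roots `± (ε_i - ε_j)`. -/
def groupA1 (i j : Fin 3) (hij : i ≠ j) : Subgroup (GL Weight R) :=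
  (embA2.comp (embSL2 (R := R) i j hij)).range

end Elementary

end ChevalleyG2

end

open scoped Matrix

noncomputable section

namespace ChevalleyG2

variable {R : Type*} [CommRing R]

/-! ## The action of the root elements on rows -/

/-- The row with prescribed coordinates, listed cyclically from the index `k`. -/
def row (k : Fin 3) (a b c a' b' c' z : R) : Weight → R :=
  Sum.elim (fun l => if l = k then a else if l = k + 1 then b else c)
    (Sum.elim (fun l => if l = k then a' else if l = k + 1 then b' else c') fun _ => z)

lemma row_eta (k : Fin 3) (r : Weight → R) :
    row k (r (.pos k)) (r (.pos (k + 1))) (r (.pos (k + 2))) (r (.neg k)) (r (.neg (k + 1)))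
      (r (.neg (k + 2))) (r .zero) = r := by
  funext w
  rcases w with l | l | l <;> fin_cases k <;> fin_cases l <;> rfl

lemma row_rotate (k : Fin 3) (a b c a' b' c' z : R) :
    row k a b c a' b' c' z = row (k + 1) b c a b' c' a' z := by
  funext w
  rcases w with l | l | l <;> fin_cases k <;> fin_cases l <;> rfl

lemma row_rotate' (k : Fin 3) (a b c a' b' c' z : R) :
    row k a b c a' b' c' z = row (k + 2) c a b c' a' b' z := by
  funext w
  rcases w with l | l | l <;> fin_cases k <;> fin_cases l <;> rfl

lemma vecMul_weight (r : Weight → R) (A : Matrix Weight Weight R) (w : Weight) :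
    (r ᵥ* A) w = r (.pos 0) * A (.pos 0) w + r (.pos 1) * A (.pos 1) w
      + r (.pos 2) * A (.pos 2) w + (r (.neg 0) * A (.neg 0) w + r (.neg 1) * A (.neg 1) w
      + r (.neg 2) * A (.neg 2) w) + r .zero * A .zero w := by
  simp [Matrix.vecMul, dotProduct, Fintype.sum_sum_type, Fin.sum_univ_three]
  ring

lemma rootVectorSq_pos (k : Fin 3) :
    rootVectorSq (.pos k) = Matrix.single (.pos k) (.neg k) 1 := by
  revert k; decide +kernel

lemma rootVectorSq_neg (k : Fin 3) :
    rootVectorSq (.neg k) = Matrix.single (.neg k) (.pos k) 1 := by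
  revert k; decide +kernel

lemma rootVectorSq_long (i j : Fin 3) (h : i ≠ j) : rootVectorSq (.long i j h) = 0 := by
  revert i j; decide +kernel

lemma row_vecMul_pos (k : Fin 3) (a b c a' b' c' z ξ : R) :
    row k a b c a' b' c' z ᵥ* rootMatrix (.pos k) ξ =
      row k a (b + ξ * c') (c - ξ * b') (a' + 2 * ξ * z + ξ ^ 2 * a) b' c' (z + ξ * a) := by
  funext w
  rw [vecMul_weight, rootMatrix, rootVectorSq_pos]
  rcases w with l | l | l <;> fin_cases k <;> fin_cases l <;>
    simp [row, rootVector] <;> ring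

lemma row_vecMul_neg (k : Fin 3) (a b c a' b' c' z ξ : R) :
    row k a b c a' b' c' z ᵥ* rootMatrix (.neg k) ξ =
      row k (a + 2 * ξ * z + ξ ^ 2 * a') b c a' (b' - ξ * c) (c' + ξ * b) (z + ξ * a') := by
  funext w
  rw [vecMul_weight, rootMatrix, rootVectorSq_neg]
  rcases w with l | l | l <;> fin_cases k <;> fin_cases l <;>
    simp [row, rootVector] <;> ring

lemma row_vecMul_long (k : Fin 3) (h : k ≠ k + 1) (a b c a' b' c' z ξ : R) :
    row k a b c a' b' c' z ᵥ* rootMatrix (.long k (k + 1) h) ξ =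
      row k a (b + ξ * a) c (a' - ξ * b') b' c' z := by
  funext w
  rw [vecMul_weight, rootMatrix, rootVectorSq_long]
  rcases w with l | l | l <;> fin_cases k <;> fin_cases l <;>
    simp [row, rootVector] <;> ring

lemma row_vecMul_long' (k : Fin 3) (h : k ≠ k + 2) (a b c a' b' c' z ξ : R) :
    row k a b c a' b' c' z ᵥ* rootMatrix (.long k (k + 2) h) ξ =
      row k a b (c + ξ * a) (a' - ξ * c') b' c' z := by
  funext w
  rw [vecMul_weight, rootMatrix, rootVectorSq_long]
  rcases w with l | l | l <;> fin_cases k <;> fin_cases l <;>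
    simp [row, rootVector] <;> ring

/-! ## Invariants -/

/-- The invariant quadratic form on rows. -/
def normForm (u : Weight → R) : R :=
  u .zero ^ 2 - (u (.pos 0) * u (.neg 0) + u (.pos 1) * u (.neg 1) + u (.pos 2) * u (.neg 2))

/-- The column that represents the polar form of `normForm` with `u`. -/
def polar (u : Weight → R) : Weight → R :=
  Sum.elim (fun l => -u (.neg l)) (Sum.elim (fun l => -u (.pos l)) fun _ => 2 * u .zero)

/-- The column that represents the invariant alternating trilinear form with `u` and `v`. -/
def cross (u v : Weight → R) : Weight → R :=
  Sum.elim
    (fun l => u (.pos (l + 1)) * v (.pos (l + 2)) - u (.pos (l + 2)) * v (.pos (l + 1))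
      - u .zero * v (.neg l) + v .zero * u (.neg l))
    (Sum.elim
      (fun l => u (.neg (l + 1)) * v (.neg (l + 2)) - u (.neg (l + 2)) * v (.neg (l + 1))
        + u .zero * v (.pos l) - v .zero * u (.pos l))
      (fun _ => u (.pos 0) * v (.neg 0) + u (.pos 1) * v (.neg 1) + u (.pos 2) * v (.neg 2)
        - (u (.neg 0) * v (.pos 0) + u (.neg 1) * v (.pos 1) + u (.neg 2) * v (.pos 2))))

lemma normForm_row (k : Fin 3) (a b c a' b' c' z : R) :
    normForm (row k a b c a' b' c' z) = z ^ 2 - (a * a' + b * b' + c * c') := by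
  fin_cases k <;> simp [row, normForm] <;> ring

lemma polar_row (k : Fin 3) (a b c a' b' c' z : R) :
    polar (row k a b c a' b' c' z) = row k (-a') (-b') (-c') (-a) (-b) (-c) (2 * z) := by
  funext w
  rcases w with l | l | l <;> fin_cases k <;> fin_cases l <;> simp [row, polar]

lemma cross_row (k : Fin 3) (a b c a' b' c' z d e f d' e' f' t : R) :
    cross (row k a b c a' b' c' z) (row k d e f d' e' f' t) =
      row k (b * f - c * e - z * d' + t * a') (c * d - a * f - z * e' + t * b')
        (a * e - b * d - z * f' + t * c') (b' * f' - c' * e' + z * d - t * a)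
        (c' * d' - a' * f' + z * e - t * b) (a' * e' - b' * d' + z * f - t * c)
        (a * d' + b * e' + c * f' - (a' * d + b' * e + c' * f)) := by
  funext w
  rcases w with l | l | l <;> fin_cases k <;> fin_cases l <;> simp [row, cross] <;> ring

lemma mulVec_weight (A : Matrix Weight Weight R) (r : Weight → R) (w : Weight) :
    (A *ᵥ r) w = A w (.pos 0) * r (.pos 0) + A w (.pos 1) * r (.pos 1)
      + A w (.pos 2) * r (.pos 2) + (A w (.neg 0) * r (.neg 0) + A w (.neg 1) * r (.neg 1)
      + A w (.neg 2) * r (.neg 2)) + A w .zero * r .zero := by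
  simp [Matrix.mulVec, dotProduct, Fintype.sum_sum_type, Fin.sum_univ_three]
  ring

lemma mulVec_row_pos (k : Fin 3) (a b c a' b' c' z ξ : R) :
    rootMatrix (.pos k) ξ *ᵥ row k a b c a' b' c' z =
      row k (a + ξ * z + ξ ^ 2 * a') b c a' (b' - ξ * c) (c' + ξ * b) (z + 2 * ξ * a') := by
  funext w
  rw [mulVec_weight, rootMatrix, rootVectorSq_pos]
  rcases w with l | l | l <;> fin_cases k <;> fin_cases l <;>
    simp [row, rootVector] <;> ring

lemma mulVec_row_neg (k : Fin 3) (a b c a' b' c' z ξ : R) :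
    rootMatrix (.neg k) ξ *ᵥ row k a b c a' b' c' z =
      row k a (b + ξ * c') (c - ξ * b') (a' + ξ * z + ξ ^ 2 * a) b' c' (z + 2 * ξ * a) := by
  funext w
  rw [mulVec_weight, rootMatrix, rootVectorSq_neg]
  rcases w with l | l | l <;> fin_cases k <;> fin_cases l <;>
    simp [row, rootVector] <;> ring

lemma mulVec_row_long (k : Fin 3) (h : k ≠ k + 1) (a b c a' b' c' z ξ : R) :
    rootMatrix (.long k (k + 1) h) ξ *ᵥ row k a b c a' b' c' z =
      row k (a + ξ * b) b c a' (b' - ξ * a') c' z := by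
  funext w
  rw [mulVec_weight, rootMatrix, rootVectorSq_long]
  rcases w with l | l | l <;> fin_cases k <;> fin_cases l <;>
    simp [row, rootVector] <;> ring

lemma mulVec_row_long' (k : Fin 3) (h : k ≠ k + 2) (a b c a' b' c' z ξ : R) :
    rootMatrix (.long k (k + 2) h) ξ *ᵥ row k a b c a' b' c' z =
      row k (a + ξ * c) b c a' b' (c' - ξ * a') z := by
  funext w
  rw [mulVec_weight, rootMatrix, rootVectorSq_long]
  rcases w with l | l | l <;> fin_cases k <;> fin_cases l <;>
    simp [row, rootVector] <;> ring

/-- Every property of the root elements follows from the case of the roots `± ε_k`,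
`ε_k - ε_{k+1}` and `ε_k - ε_{k+2}`. -/
lemma Root.cases_cyclic {P : Root → Prop} (h1 : ∀ k, P (.pos k)) (h2 : ∀ k, P (.neg k))
    (h3 : ∀ k h, P (.long k (k + 1) h)) (h4 : ∀ k h, P (.long k (k + 2) h)) (α : Root) : P α := by
  rcases α with k | k | ⟨i, j, h⟩
  · exact h1 k
  · exact h2 k
  · have : j = i + 1 ∨ j = i + 2 := by revert i j; decide
    rcases this with rfl | rfl
    · exact h3 i h
    · exact h4 i h

lemma normForm_vecMul_rootMatrix (α : Root) (ξ : R) (u : Weight → R) :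
    normForm (u ᵥ* rootMatrix α ξ) = normForm u := by
  revert u
  induction α using Root.cases_cyclic with
  | h1 k => intro u; rw [← row_eta k u, row_vecMul_pos, normForm_row, normForm_row]; ring
  | h2 k => intro u; rw [← row_eta k u, row_vecMul_neg, normForm_row, normForm_row]; ring
  | h3 k => intro u; rw [← row_eta k u, row_vecMul_long, normForm_row, normForm_row]; ring
  | h4 k => intro u; rw [← row_eta k u, row_vecMul_long', normForm_row, normForm_row]; ring

lemma mulVec_polar_rootMatrix (α : Root) (ξ : R) (u : Weight → R) :
    rootMatrix α ξ *ᵥ polar (u ᵥ* rootMatrix α ξ) = polar u := by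
  revert u
  induction α using Root.cases_cyclic with
  | h1 k =>
    intro u; rw [← row_eta k u, row_vecMul_pos, polar_row, polar_row, mulVec_row_pos]
    congr 1 <;> ring
  | h2 k =>
    intro u; rw [← row_eta k u, row_vecMul_neg, polar_row, polar_row, mulVec_row_neg]
    congr 1 <;> ring
  | h3 k =>
    intro u; rw [← row_eta k u, row_vecMul_long, polar_row, polar_row, mulVec_row_long]
    congr 1 <;> ring
  | h4 k =>
    intro u; rw [← row_eta k u, row_vecMul_long', polar_row, polar_row, mulVec_row_long']
    congr 1 <;> ring

lemma mulVec_cross_rootMatrix (α : Root) (ξ : R) (u v : Weight → R) :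
    rootMatrix α ξ *ᵥ cross (u ᵥ* rootMatrix α ξ) (v ᵥ* rootMatrix α ξ) = cross u v := by
  revert u v
  induction α using Root.cases_cyclic with
  | h1 k =>
    intro u v; rw [← row_eta k u, ← row_eta k v, row_vecMul_pos, row_vecMul_pos, cross_row,
      cross_row, mulVec_row_pos]
    congr 1 <;> ring
  | h2 k =>
    intro u v; rw [← row_eta k u, ← row_eta k v, row_vecMul_neg, row_vecMul_neg, cross_row,
      cross_row, mulVec_row_neg]
    congr 1 <;> ring
  | h3 k =>
    intro u v; rw [← row_eta k u, ← row_eta k v, row_vecMul_long, row_vecMul_long, cross_row,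
      cross_row, mulVec_row_long]
    congr 1 <;> ring
  | h4 k =>
    intro u v; rw [← row_eta k u, ← row_eta k v, row_vecMul_long', row_vecMul_long', cross_row,
      cross_row, mulVec_row_long']
    congr 1 <;> ring

/-! ## Consequences of the absolute stable range condition -/

lemma ASR.exists_maximal_mem (hR : ASR R 3) (a b c : R) : ∃ s t : R, ∀ M : Ideal R,
    M.IsMaximal → a + c * s ∈ M → b + c * t ∈ M → a ∈ M ∧ b ∈ M ∧ c ∈ M := by
  obtain ⟨v, hv⟩ := hR 2 rfl ![a, b, c]
  refine ⟨v 0, v 1, fun M hM h0 h1 => ?_⟩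
  have key : ∀ i : Fin 3, ![a, b, c] i ∈ M := fun i => by
    have h2 : ![a, b, c] i ∈ rowRadical ![a, b, c] := by
      refine Ideal.mem_sInf.2 ?_
      rintro N ⟨-, hN⟩
      exact hN i
    rw [← hv] at h2
    refine Ideal.mem_sInf.1 h2 ⟨hM, fun i => ?_⟩
    fin_cases i
    · exact h0
    · exact h1
  exact ⟨key 0, key 1, key 2⟩

/-- In the absolute stable range condition the coefficients may be prescribed modulo `c`. -/
lemma ASR.exists_maximal_mem_of_prescribed (hR : ASR R 3) (a b c p q : R) :
    ∃ s t : R, ∀ M : Ideal R, M.IsMaximal → a + c * (p + c * s) ∈ M → b + c * (q + c * t) ∈ M →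
      a ∈ M ∧ b ∈ M ∧ c ∈ M := by
  obtain ⟨s, t, h⟩ := hR.exists_maximal_mem (a + c * p) (b + c * q) (c ^ 2)
  refine ⟨s, t, fun M hM h1 h2 => ?_⟩
  obtain ⟨h3, h4, h5⟩ := h M hM (by convert h1 using 1; ring) (by convert h2 using 1; ring)
  have hc := hM.isPrime.mem_of_pow_mem 2 h5
  exact ⟨(Ideal.add_mem_iff_left M (M.mul_mem_right p hc)).1 h3,
    (Ideal.add_mem_iff_left M (M.mul_mem_right q hc)).1 h4, hc⟩

lemma exists_eq_one_of_forall_maximal {a b : R}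
    (h : ∀ M : Ideal R, M.IsMaximal → a ∈ M → b ∈ M → False) : ∃ s t : R, s * a + t * b = 1 := by
  have h1 : Ideal.span {a, b} = ⊤ := by
    by_contra hne
    obtain ⟨M, hM, hle⟩ := Ideal.exists_le_maximal _ hne
    exact h M hM (hle (Ideal.subset_span (by simp))) (hle (Ideal.subset_span (by simp)))
  exact Ideal.mem_span_pair.1 (h1 ▸ Submodule.mem_top)

/-! ## Reduction of rows -/

/-- The row `s` arises from `r` by right multiplication with a product of at most `L` root elements
that fixes the row `p`. -/
def Reach (p : Weight → R) (L : ℕ) (r s : Weight → R) : Prop :=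
  ∃ e ∈ elementaryProducts R L, r ᵥ* (e : Matrix Weight Weight R) = s ∧
    p ᵥ* (e : Matrix Weight Weight R) = p

lemma Reach.trans {p : Weight → R} {L L' : ℕ} {r s t : Weight → R} (h : Reach p L r s)
    (h' : Reach p L' s t) : Reach p (L + L') r t := by
  obtain ⟨_, ⟨l, hl, hlr, rfl⟩, rfl, hp⟩ := h
  obtain ⟨_, ⟨l', hl', hlr', rfl⟩, rfl, hp'⟩ := h'
  refine ⟨(l ++ l').prod, ⟨l ++ l', ?_, ?_, rfl⟩, ?_, ?_⟩
  · rw [List.length_append]; omega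
  · intro x hx
    rcases List.mem_append.1 hx with hx | hx
    exacts [hlr x hx, hlr' x hx]
  · rw [List.prod_append, Units.val_mul, Matrix.vecMul_vecMul]
  · rw [List.prod_append, Units.val_mul, ← Matrix.vecMul_vecMul, hp, hp']

lemma reach_rootMatrix {p r s : Weight → R} (α : Root) (ξ : R) (h : r ᵥ* rootMatrix α ξ = s)
    (hp : p ᵥ* rootMatrix α ξ = p) : Reach p 1 r s :=
  ⟨rootElement α ξ, ⟨[rootElement α ξ], le_rfl, by simpa using ⟨α, ξ, rfl⟩, by simp⟩, h, hp⟩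

lemma row_vecMul_pos_succ (k : Fin 3) (a b c a' b' c' z ξ : R) :
    row k a b c a' b' c' z ᵥ* rootMatrix (.pos (k + 1)) ξ =
      row k (a - ξ * c') b (c + ξ * a') a' (b' + 2 * ξ * z + ξ ^ 2 * b) c' (z + ξ * b) := by
  rw [row_rotate, row_rotate k (a - ξ * c'), row_vecMul_pos]

lemma row_vecMul_pos_succ_succ (k : Fin 3) (a b c a' b' c' z ξ : R) :
    row k a b c a' b' c' z ᵥ* rootMatrix (.pos (k + 2)) ξ =
      row k (a + ξ * b') (b - ξ * a') c a' b' (c' + 2 * ξ * z + ξ ^ 2 * c) (z + ξ * c) := by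
  rw [row_rotate', row_rotate' k (a + ξ * b'), row_vecMul_pos]

lemma row_vecMul_neg_succ (k : Fin 3) (a b c a' b' c' z ξ : R) :
    row k a b c a' b' c' z ᵥ* rootMatrix (.neg (k + 1)) ξ =
      row k a (b + 2 * ξ * z + ξ ^ 2 * b') c (a' + ξ * c) b' (c' - ξ * a) (z + ξ * b') := by
  rw [row_rotate, row_rotate k a (b + 2 * ξ * z + ξ ^ 2 * b'), row_vecMul_neg]

lemma row_vecMul_neg_succ_succ (k : Fin 3) (a b c a' b' c' z ξ : R) :
    row k a b c a' b' c' z ᵥ* rootMatrix (.neg (k + 2)) ξ =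
      row k a b (c + 2 * ξ * z + ξ ^ 2 * c') (a' - ξ * b) (b' + ξ * a) c' (z + ξ * c') := by
  rw [row_rotate', row_rotate' k a b (c + 2 * ξ * z + ξ ^ 2 * c'), row_vecMul_neg]

lemma row_vecMul_long_succ (k : Fin 3) (a b c a' b' c' z ξ : R) :
    row k a b c a' b' c' z ᵥ*
        rootMatrix (.long (k + 1) (k + 1 + 2) (by revert k; decide)) ξ =
      row k (a + ξ * b) b c a' (b' - ξ * a') c' z := by
  rw [row_rotate, row_rotate k (a + ξ * b), row_vecMul_long']

lemma row_vecMul_long_succ_succ (k : Fin 3) (a b c a' b' c' z ξ : R) :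
    row k a b c a' b' c' z ᵥ*
        rootMatrix (.long (k + 2) (k + 2 + 1) (by revert k; decide)) ξ =
      row k (a + ξ * c) b c a' b' (c' - ξ * a') z := by
  rw [row_rotate', row_rotate' k (a + ξ * c), row_vecMul_long]

lemma Reach.normForm_eq {p : Weight → R} {L : ℕ} {r s : Weight → R} (h : Reach p L r s) :
    normForm s = normForm r := by
  obtain ⟨_, ⟨l, -, hl, rfl⟩, rfl, -⟩ := h
  induction l generalizing r with
  | nil => simp
  | cons x l ih =>
    obtain ⟨α, ξ, hx⟩ := hl x (by simp)
    rw [List.prod_cons, Units.val_mul, ← Matrix.vecMul_vecMul,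
      ih fun y hy => hl y (List.mem_cons_of_mem _ hy), hx]
    exact normForm_vecMul_rootMatrix α ξ r

/-- An isotropic row whose coordinate at `ε_k` is `1` is moved to the basis row by the unipotent
radical of a parabolic subgroup. -/
lemma reach_basis_pos (k : Fin 3) (b c a' b' c' z : R)
    (h : normForm (row k 1 b c a' b' c' z) = 0) :
    Reach 0 5 (row k 1 b c a' b' c' z) (row k 1 0 0 0 0 0 0) := by
  have h0 : ∀ A : Matrix Weight Weight R, (0 : Weight → R) ᵥ* A = 0 := Matrix.zero_vecMul
  have hk1 : k ≠ k + 1 := by clear h; revert k; decide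
  have hk2 : k ≠ k + 2 := by clear h; revert k; decide
  have h1 : ∃ A B C Z, Reach 0 2 (row k 1 b c a' b' c' z) (row k 1 B C A 0 0 Z) := by
    have H := (reach_rootMatrix _ c' (row_vecMul_neg_succ k 1 b c a' b' c' z c') (h0 _)).trans
      (reach_rootMatrix _ (-b') (row_vecMul_neg_succ_succ ..) (h0 _))
    rw [show b' + -b' * 1 = 0 by ring, show c' - c' * 1 = 0 by ring] at H
    exact ⟨_, _, _, _, H⟩
  obtain ⟨A, B, C, Z, H1⟩ := h1
  have h2 : ∃ A', Reach 0 3 (row k 1 B C A 0 0 Z) (row k 1 0 0 A' 0 0 0) := by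
    have H := ((reach_rootMatrix _ (-Z) (row_vecMul_pos k 1 B C A 0 0 Z (-Z)) (h0 _)).trans
      (reach_rootMatrix _ (-B) (row_vecMul_long _ hk1 ..) (h0 _))).trans
      (reach_rootMatrix _ (-C) (row_vecMul_long' _ hk2 ..) (h0 _))
    rw [show B + -Z * 0 + -B * 1 = 0 by ring, show C - -Z * 0 + -C * 1 = 0 by ring,
      show Z + -Z * 1 = 0 by ring] at H
    exact ⟨_, H⟩
  obtain ⟨A', H2⟩ := h2
  have H := H1.trans H2
  have hn := H.normForm_eq.trans h
  rw [normForm_row] at hn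
  obtain rfl : A' = 0 := by linear_combination -hn
  exact H

/-- The analogue of `reach_basis_pos` for the weight `-ε_k`. -/
lemma reach_basis_neg (k : Fin 3) (a b c b' c' z : R)
    (h : normForm (row k a b c 1 b' c' z) = 0) :
    Reach (row k 1 0 0 0 0 0 0) 5 (row k a b c 1 b' c' z) (row k 0 0 0 1 0 0 0) := by
  have h1 : ∃ A B C Z, Reach (row k 1 0 0 0 0 0 0) 2 (row k a b c 1 b' c' z)
      (row k A 0 0 1 B C Z) := by
    have H := (reach_rootMatrix (p := row k 1 0 0 0 0 0 0) _ (-c)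
      (row_vecMul_pos_succ k a b c 1 b' c' z (-c))
      (by rw [row_vecMul_pos_succ]; congr 1 <;> ring)).trans
      (reach_rootMatrix _ b (row_vecMul_pos_succ_succ ..)
      (by rw [row_vecMul_pos_succ_succ]; congr 1 <;> ring))
    rw [show b - b * 1 = 0 by ring, show c + -c * 1 = 0 by ring] at H
    exact ⟨_, _, _, _, H⟩
  obtain ⟨A, B, C, Z, H1⟩ := h1
  have h2 : ∃ A', Reach (row k 1 0 0 0 0 0 0) 3 (row k A 0 0 1 B C Z) (row k A' 0 0 1 0 0 0) := by
    have H := ((reach_rootMatrix (p := row k 1 0 0 0 0 0 0) _ (-Z)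
      (row_vecMul_neg k A 0 0 1 B C Z (-Z)) (by rw [row_vecMul_neg]; congr 1 <;> ring)).trans
      (reach_rootMatrix _ B (row_vecMul_long_succ ..)
      (by rw [row_vecMul_long_succ]; congr 1 <;> ring))).trans
      (reach_rootMatrix _ C (row_vecMul_long_succ_succ ..)
      (by rw [row_vecMul_long_succ_succ]; congr 1 <;> ring))
    rw [show B - -Z * 0 - B * 1 = 0 by ring, show C + -Z * 0 - C * 1 = 0 by ring,
      show Z + -Z * 1 = 0 by ring] at H
    exact ⟨_, H⟩
  obtain ⟨A', H2⟩ := h2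
  have H := H1.trans H2
  have hn := H.normForm_eq.trans h
  rw [normForm_row] at hn
  obtain rfl : A' = 0 := by linear_combination -hn
  exact H

/-- Under `ASR_3`, an isotropic row that is not zero modulo any maximal ideal is moved to the basis
row of the weight `ε_k` by a product of `13` root elements. -/
lemma reach_basis (hR : ASR R 3) (k : Fin 3) (r : Weight → R) (hr : normForm r = 0)
    (hmax : ∀ M : Ideal R, M.IsMaximal → ¬ ∀ w, r w ∈ M) :
    Reach 0 13 r (row k 1 0 0 0 0 0 0) := by
  have h0 : ∀ A : Matrix Weight Weight R, (0 : Weight → R) ᵥ* A = 0 := Matrix.zero_vecMul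
  have hk1 : k ≠ k + 1 := by clear hr; revert k; decide
  have hk2 : k ≠ k + 2 := by clear hr; revert k; decide
  rw [← row_eta k r] at hr ⊢
  have hmax' : ∀ M : Ideal R, M.IsMaximal → r (.pos k) ∈ M → r (.pos (k + 1)) ∈ M →
      r (.pos (k + 2)) ∈ M → r (.neg k) ∈ M → r (.neg (k + 1)) ∈ M → r (.neg (k + 2)) ∈ M →
      r .zero ∈ M → False := by
    intro M hM h1 h2 h3 h4 h5 h6 h7
    refine hmax M hM ?_
    have : ∀ l, l = k ∨ l = k + 1 ∨ l = k + 2 := by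
      clear * -
      revert k; decide
    rintro (l | l | l)
    · rcases this l with rfl | rfl | rfl <;> assumption
    · rcases this l with rfl | rfl | rfl <;> assumption
    · exact h7
  clear hmax
  generalize r (.pos k) = a, r (.pos (k + 1)) = b, r (.pos (k + 2)) = c, r (.neg k) = a',
    r (.neg (k + 1)) = b', r (.neg (k + 2)) = c', r .zero = z at *
  -- the coordinates at `ε_{k+1}`, `ε_{k+2}` generate the radical of the `ε`-coordinates
  obtain ⟨s, t, hst⟩ := hR.exists_maximal_mem b c a
  have H1 := (reach_rootMatrix _ s (row_vecMul_long k hk1 a b c a' b' c' z s) (h0 _)).trans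
    (reach_rootMatrix _ t (row_vecMul_long' k hk2 ..) (h0 _))
  have hn := H1.normForm_eq.trans hr
  rw [mul_comm s, mul_comm t] at H1 hn
  have hmax1 : ∀ M : Ideal R, M.IsMaximal → b + a * s ∈ M → c + a * t ∈ M →
      a' - s * b' - t * c' ∈ M → b' ∈ M → c' ∈ M → False := by
    intro M hM h1 h2 h3 h4 h5
    obtain ⟨h6, h7, h8⟩ := hst M hM h1 h2
    have h9 : a' ∈ M := by
      have := M.add_mem (M.add_mem h3 (M.mul_mem_left s h4)) (M.mul_mem_left t h5)
      convert this using 1; ring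
    refine hmax' M hM h8 h6 h7 h9 h4 h5 (hM.isPrime.mem_of_pow_mem 2 ?_)
    rw [normForm_row, sub_eq_zero] at hr
    rw [hr]
    exact M.add_mem (M.add_mem (M.mul_mem_right _ h8) (M.mul_mem_right _ h6))
      (M.mul_mem_right _ h7)
  clear hmax' hst
  generalize b + a * s = b, c + a * t = c, a' - s * b' - t * c' = a' at *
  -- the `ε`-coordinates become unimodular
  have hpq : ∃ p q : R, ∃ u ∈ Ideal.span {b, c, a'}, a - p * b' - q * c' = 1 + u := by
    have htop : Ideal.span {b, c, a'} ⊔ Ideal.span {b', c'} = ⊤ := by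
      by_contra hne
      obtain ⟨M, hM, hle⟩ := Ideal.exists_le_maximal _ hne
      have h1 : ∀ x ∈ ({b, c, a'} : Set R), x ∈ M := fun x hx =>
        hle (Ideal.mem_sup_left (Ideal.subset_span hx))
      have h2 : ∀ x ∈ ({b', c'} : Set R), x ∈ M := fun x hx =>
        hle (Ideal.mem_sup_right (Ideal.subset_span hx))
      exact hmax1 M hM (h1 _ (by simp)) (h1 _ (by simp)) (h1 _ (by simp)) (h2 _ (by simp))
        (h2 _ (by simp))
    obtain ⟨u, hu, v, hv, huv⟩ := Submodule.mem_sup.1 (htop ▸ Submodule.mem_top (x := a - 1))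
    obtain ⟨p, q, rfl⟩ := Ideal.mem_span_pair.1 hv
    exact ⟨p, q, u, hu, by linear_combination -huv⟩
  obtain ⟨p, q, u, hu, hpqu⟩ := hpq
  obtain ⟨s', t', hst⟩ := hR.exists_maximal_mem_of_prescribed b c a' p q
  have H2 := (reach_rootMatrix _ (-(p + a' * s'))
    (row_vecMul_pos_succ_succ k a b c a' b' c' z (-(p + a' * s'))) (h0 _)).trans
    (reach_rootMatrix _ (q + a' * t') (row_vecMul_pos_succ ..) (h0 _))
  have hmax2 : ∀ M : Ideal R, M.IsMaximal →
      b - -(p + a' * s') * a' ∈ M → c + (q + a' * t') * a' ∈ M →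
      a + -(p + a' * s') * b' - (q + a' * t') *
        (c' + 2 * -(p + a' * s') * z + (-(p + a' * s')) ^ 2 * c) ∈ M → False := by
    intro M hM h1 h2 h3
    obtain ⟨h4, h5, h6⟩ := hst M hM (by convert h1 using 1; ring) (by convert h2 using 1; ring)
    have h7 : z ∈ M := by
      rw [normForm_row, sub_eq_zero] at hn
      refine hM.isPrime.mem_of_pow_mem 2 ?_
      rw [hn]
      exact M.add_mem (M.add_mem (M.mul_mem_left _ h6) (M.mul_mem_right _ h4))
        (M.mul_mem_right _ h5)
    have h8 : u ∈ M := by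
      refine (Ideal.span_le.2 ?_ : Ideal.span {b, c, a'} ≤ M) hu
      rintro x (rfl | rfl | rfl) <;> assumption
    refine (Ideal.ne_top_iff_one M).1 hM.ne_top ?_
    have h9 := M.sub_mem h3 h8
    have h10 := M.mul_mem_left (s' * b' + t' * c') h6
    have h11 := M.mul_mem_left (2 * -(p + a' * s') * (q + a' * t')) h7
    have h12 := M.mul_mem_left ((-(p + a' * s')) ^ 2 * (q + a' * t')) h5
    have h13 := M.add_mem (M.add_mem (M.add_mem h9 h10) h11) h12
    convert h13 using 1
    linear_combination -hpqu
  have H3 := H1.trans H2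
  have hn2 := H2.normForm_eq.trans hn
  clear H1 H2 hn hmax1 hst hu hpqu
  generalize b - -(p + a' * s') * a' = b₁, c + (q + a' * t') * a' = c₁,
    a + -(p + a' * s') * b' - (q + a' * t') *
        (c' + 2 * -(p + a' * s') * z + (-(p + a' * s')) ^ 2 * c) = a₁ at *
  -- two of the `ε`-coordinates become unimodular
  obtain ⟨s, t, hst⟩ := hR.exists_maximal_mem b₁ c₁ a₁
  have H4 := H3.trans ((reach_rootMatrix _ s (row_vecMul_long _ hk1 ..) (h0 _)).trans
    (reach_rootMatrix _ t (row_vecMul_long' k hk2 ..) (h0 _)))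
  obtain ⟨d, e, hde⟩ := exists_eq_one_of_forall_maximal (a := b₁ + s * a₁) (b := c₁ + t * a₁)
    (by
      intro M hM h1 h2
      rw [mul_comm] at h1 h2
      obtain ⟨h3, h4, h5⟩ := hst M hM h1 h2
      exact hmax2 M hM h3 h4 h5)
  have H5 := H4.trans ((reach_rootMatrix _ ((1 - a₁) * d) (row_vecMul_long_succ ..) (h0 _)).trans
    (reach_rootMatrix _ ((1 - a₁) * e) (row_vecMul_long_succ_succ k ..) (h0 _)))
  rw [show a₁ + (1 - a₁) * d * (b₁ + s * a₁) + (1 - a₁) * e * (c₁ + t * a₁) = 1 by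
    linear_combination (1 - a₁) * hde] at H5
  exact H5.trans (reach_basis_pos _ _ _ _ _ _ _ (H5.normForm_eq.trans hr))

/-! ## Functoriality of the schematic closure -/

lemma evalAt_map {n : Type*} [Fintype n] [DecidableEq n] {A B : Type*} [CommRing A] [CommRing B]
    (φ : A →+* B) (g : GL n A) (f : RegFun n) :
    evalAt (Matrix.GeneralLinearGroup.map φ g) f = φ (evalAt g f) := by
  have : evalAt (Matrix.GeneralLinearGroup.map φ g) = (φ.toIntAlgHom).comp (evalAt g) := by
    apply MvPolynomial.algHom_ext
    rintro (⟨i, j⟩ | ⟨i, j⟩)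
    · simp [evalAt, coords]
    · simp only [evalAt, coords, MvPolynomial.aeval_X, Sum.elim_inr, AlgHom.comp_apply]
      rw [← map_inv]
      rfl
  rw [this]; rfl

lemma map_mem_schematicClosure {n : Type*} [Fintype n] [DecidableEq n] {Γ : Subgroup (GL n ℚ)}
    {A B : Type*} [CommRing A] [CommRing B] (φ : A →+* B) {g : GL n A}
    (hg : g ∈ schematicClosure Γ A) :
    Matrix.GeneralLinearGroup.map φ g ∈ schematicClosure Γ B := by
  intro f hf
  rw [evalAt_map, hg f hf, map_zero]

lemma mem_schematicClosure_of_map {n : Type*} [Fintype n] [DecidableEq n] {Γ : Subgroup (GL n ℚ)}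
    {A B : Type*} [CommRing A] [CommRing B] (φ : A →+* B) (hφ : Function.Injective φ) {g : GL n A}
    (hg : Matrix.GeneralLinearGroup.map φ g ∈ schematicClosure Γ B) :
    g ∈ schematicClosure Γ A := by
  intro f hf
  apply hφ
  rw [← evalAt_map, hg f hf, map_zero]

lemma map_rootElement {A B : Type*} [CommRing A] [CommRing B] (φ : A →+* B) (α : Root) (ξ : A) :
    Matrix.GeneralLinearGroup.map φ (rootElement α ξ) = rootElement α (φ ξ) := by
  apply Units.ext
  ext i j
  simp [rootElement, rootMatrix, Matrix.one_apply, apply_ite φ]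

lemma rootElement_mem_groupG2 (α : Root) (ξ : R) : rootElement α ξ ∈ groupG2 R := by
  have huniv : rootElement α (Polynomial.X : Polynomial ℤ) ∈ groupG2 (Polynomial ℤ) := by
    intro f hf
    apply Polynomial.funext
    intro q
    have h := hf (rootElement α (q : ℚ))
      (Subgroup.subset_closure ⟨α, (q : ℚ), rfl⟩)
    have h1 : rootElement α (q : ℚ) = Matrix.GeneralLinearGroup.map
        ((Int.castRingHom ℚ).comp (Polynomial.evalRingHom q)) (rootElement α Polynomial.X) := by
      rw [map_rootElement]; simp
    rw [h1, evalAt_map] at h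
    simpa using h
  have h2 : rootElement α ξ = Matrix.GeneralLinearGroup.map
      (Polynomial.aeval ξ : Polynomial ℤ →ₐ[ℤ] R).toRingHom (rootElement α Polynomial.X) := by
    rw [map_rootElement]; simp
  rw [h2]
  exact map_mem_schematicClosure _ huniv

lemma elementaryProducts_subset (L : ℕ) :
    elementaryProducts R L ⊆ (groupG2 R : Set (GL Weight R)) := by
  rintro _ ⟨l, -, hl, rfl⟩
  refine Subgroup.list_prod_mem _ fun x hx => ?_
  obtain ⟨α, ξ, rfl⟩ := hl x hx
  exact rootElement_mem_groupG2 α ξ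

/-! ## The long root subgroup of type `A_2` -/

lemma embA2_transvection {i j : Fin 3} (hij : i ≠ j) (ξ : R) :
    embA2 (Matrix.SpecialLinearGroup.transvection hij ξ) = rootElement (.long i j hij) ξ := by
  apply Units.ext
  change embA2Matrix _ = rootMatrix _ _
  rw [rootMatrix, rootVectorSq_long]
  simp only [embA2Matrix, MonoidHom.coe_mk, OneHom.coe_mk,
    Matrix.SpecialLinearGroup.transvection_inv, Matrix.SpecialLinearGroup.transvection_coe]
  ext w v
  rcases w with w | w | w <;> rcases v with v | v | v <;>
    simp [rootVector, Matrix.one_apply, Matrix.single_apply, Matrix.fromBlocks] <;> grind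

lemma diag2n_eq {K : Type*} [Field K] {i j : Fin 3} (hij : i ≠ j) {c : K} (hc : c ≠ 0) :
    Matrix.SpecialLinearGroup.diag2n hij c hc =
      .transvection hij c * .transvection hij.symm (-c⁻¹) * .transvection hij c *
        (.transvection hij (-1) * .transvection hij.symm 1 * .transvection hij (-1)) := by
  apply Subtype.ext
  have hji := hij.symm
  simp only [Matrix.SpecialLinearGroup.coe_mul, Matrix.SpecialLinearGroup.transvection_coe,
    Matrix.SpecialLinearGroup.diag2n_coe, mul_add, add_mul, one_mul, mul_one,
    Matrix.single_mul_single_same, Matrix.single_mul_single_of_ne _ _ _ _ hij,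
    Matrix.single_mul_single_of_ne _ _ _ _ hji, add_zero]
  ext a b
  simp only [Matrix.add_apply, Matrix.single_apply, Matrix.diagonal_apply, Matrix.one_apply]
  have h1 : c * c⁻¹ = 1 := mul_inv_cancel₀ hc
  have h2 : c⁻¹ * c = 1 := inv_mul_cancel₀ hc
  split_ifs <;> grind

lemma embA2_mem_groupG2_of_field {K : Type*} [Field K] (g : Matrix.SpecialLinearGroup (Fin 3) K) :
    embA2 g ∈ groupG2 K := by
  have ht : ∀ (i j : Fin 3) (hij : i ≠ j) (a : K),
      embA2 (Matrix.SpecialLinearGroup.transvection hij a) ∈ groupG2 K := fun i j hij a => by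
    rw [embA2_transvection]
    exact rootElement_mem_groupG2 _ _
  refine Matrix.SpecialLinearGroup.diagonal_transvection_induction'
    (fun g => embA2 g ∈ groupG2 K) g (fun i j hij c hc => ?_) ht fun A B hA hB => ?_
  · simp only [diag2n_eq hij hc, map_mul]
    exact mul_mem (mul_mem (mul_mem (ht _ _ _ _) (ht _ _ _ _)) (ht _ _ _ _))
      (mul_mem (mul_mem (ht _ _ _ _) (ht _ _ _ _)) (ht _ _ _ _))
  · simp only [map_mul]
    exact mul_mem hA hB

lemma map_embA2 {A B : Type*} [CommRing A] [CommRing B] (φ : A →+* B)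
    (g : Matrix.SpecialLinearGroup (Fin 3) A) :
    Matrix.GeneralLinearGroup.map φ (embA2 g) = embA2 (Matrix.SpecialLinearGroup.map φ g) := by
  apply Units.ext
  change (embA2Matrix g).map φ = embA2Matrix _
  simp only [embA2Matrix, MonoidHom.coe_mk, OneHom.coe_mk, ← map_inv]
  rw [Matrix.fromBlocks_map, Matrix.fromBlocks_map]
  simp only [Matrix.map_zero _ (map_zero φ), Matrix.map_one φ (map_zero φ) (map_one φ)]
  rfl

/-- Every element of `SL_3(R)` comes from an element of `SL_3(A)` for some domain `A`. -/
lemma exists_domain_map_eq (g : Matrix.SpecialLinearGroup (Fin 3) R) :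
    ∃ (A : Type) (_ : CommRing A) (_ : IsDomain A) (φ : A →+* R)
      (h : Matrix.SpecialLinearGroup (Fin 3) A), Matrix.SpecialLinearGroup.map φ h = g := by
  let X := Matrix.mvPolynomialX (Fin 3) (Fin 3) ℤ
  have hd : X.det ≠ 0 := Matrix.det_mvPolynomialX_ne_zero (Fin 3) ℤ
  let A := Localization.Away X.det
  have : IsDomain A := IsLocalization.isDomain_localization
    (Submonoid.powers_le.2 (mem_nonZeroDivisors_of_ne_zero hd))
  let ψ : MvPolynomial (Fin 3 × Fin 3) ℤ →+* R :=
    (MvPolynomial.aeval fun p => g.1 p.1 p.2).toRingHom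
  have hψX : X.map ψ = g.1 := by
    ext i j
    simp [X, ψ, Matrix.mvPolynomialX]
  have hψ : ψ X.det = 1 := by
    rw [RingHom.map_det]
    exact (congrArg Matrix.det hψX).trans g.2
  let φ : A →+* R := IsLocalization.Away.lift X.det (g := ψ) (by rw [hψ]; exact isUnit_one)
  have hφ : ∀ x, φ (algebraMap _ A x) = ψ x := fun x => IsLocalization.Away.lift_eq _ _ x
  let u : A := IsLocalization.Away.invSelf X.det
  have hu : algebraMap _ A X.det * u = 1 := IsLocalization.Away.mul_invSelf X.det
  have hφu : φ u = 1 := by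
    have := congrArg φ hu
    rwa [map_mul, hφ, hψ, one_mul, map_one] at this
  refine ⟨A, inferInstance, this, φ,
    ⟨Matrix.diagonal ![u, 1, 1] * X.map (algebraMap _ A), ?_⟩, ?_⟩
  · rw [Matrix.det_mul, Matrix.det_diagonal, Fin.prod_univ_three]
    have : (X.map (algebraMap _ A)).det = algebraMap _ A X.det := (RingHom.map_det _ _).symm
    rw [this]
    simpa [mul_comm] using hu
  · ext i j
    change φ ((Matrix.diagonal ![u, 1, 1] * X.map (algebraMap _ A)) i j) = g.1 i j
    rw [Matrix.diagonal_mul, map_mul, Matrix.map_apply, hφ]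
    have h1 : φ (![u, 1, 1] i) = 1 := by fin_cases i <;> simp [hφu]
    rw [h1, one_mul]
    exact congrFun (congrFun hψX i) j

lemma groupA2_le_groupG2 : groupA2 R ≤ groupG2 R := by
  rintro _ ⟨g, rfl⟩
  obtain ⟨A, _, _, φ, h, rfl⟩ := exists_domain_map_eq g
  rw [← map_embA2]
  refine map_mem_schematicClosure φ
    (mem_schematicClosure_of_map (algebraMap A (FractionRing A))
      (IsFractionRing.injective _ _) ?_)
  rw [map_embA2]
  exact embA2_mem_groupG2_of_field _

lemma groupA1_le_groupA2 (i j : Fin 3) (hij : i ≠ j) : groupA1 R i j hij ≤ groupA2 R := by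
  rintro _ ⟨g, rfl⟩
  exact ⟨embSL2 i j hij g, rfl⟩

/-! ## Equations of the Chevalley group -/

lemma normForm_comp {A B : Type*} [CommRing A] [CommRing B] (φ : A →+* B) (u : Weight → A) :
    normForm (φ ∘ u) = φ (normForm u) := by
  simp [normForm]

lemma polar_comp {A B : Type*} [CommRing A] [CommRing B] (φ : A →+* B) (u : Weight → A) :
    polar (φ ∘ u) = φ ∘ polar u := by
  funext w
  rcases w with l | l | l <;> simp [polar, map_ofNat]

lemma cross_comp {A B : Type*} [CommRing A] [CommRing B] (φ : A →+* B) (u v : Weight → A) :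
    cross (φ ∘ u) (φ ∘ v) = φ ∘ cross u v := by
  funext w
  rcases w with l | l | l <;> simp [cross]

/-- The subgroup of `GL_7(R)` that preserves the quadratic form and the trilinear form. -/
def isometryGroup (R : Type*) [CommRing R] : Subgroup (GL Weight R) where
  carrier := {g | (∀ u, normForm (u ᵥ* g.1) = normForm u) ∧
    (∀ u, g.1 *ᵥ polar (u ᵥ* g.1) = polar u) ∧
    ∀ u v, g.1 *ᵥ cross (u ᵥ* g.1) (v ᵥ* g.1) = cross u v}
  one_mem' := by simp
  mul_mem' := by
    rintro g h ⟨g1, g2, g3⟩ ⟨h1, h2, h3⟩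
    refine ⟨fun u => ?_, fun u => ?_, fun u v => ?_⟩
    · rw [Units.val_mul, ← Matrix.vecMul_vecMul, h1, g1]
    · rw [Units.val_mul, ← Matrix.vecMul_vecMul, ← Matrix.mulVec_mulVec, h2, g2]
    · rw [Units.val_mul, ← Matrix.vecMul_vecMul, ← Matrix.vecMul_vecMul, ← Matrix.mulVec_mulVec,
        h3, g3]
  inv_mem' := by
    rintro g ⟨g1, g2, g3⟩
    have hl : (g⁻¹ : GL Weight R).1 * g.1 = 1 := g.inv_mul
    refine ⟨fun u => ?_, fun u => ?_, fun u v => ?_⟩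
    · rw [← g1, Matrix.vecMul_vecMul, hl, Matrix.vecMul_one]
    · rw [← g2, Matrix.vecMul_vecMul, hl, Matrix.vecMul_one, Matrix.mulVec_mulVec, hl,
        Matrix.one_mulVec]
    · rw [← g3, Matrix.vecMul_vecMul, Matrix.vecMul_vecMul, hl, Matrix.vecMul_one,
        Matrix.vecMul_one, Matrix.mulVec_mulVec, hl, Matrix.one_mulVec]

lemma elementaryGroup_le_isometryGroup : elementaryGroup R ≤ isometryGroup R := by
  refine (Subgroup.closure_le _).2 ?_
  rintro _ ⟨α, ξ, rfl⟩
  exact ⟨normForm_vecMul_rootMatrix α ξ, mulVec_polar_rootMatrix α ξ, mulVec_cross_rootMatrix α ξ⟩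

/-- The row `a` of the generic matrix. -/
def genericRow (a : Weight) : Weight → RegFun Weight := fun w => MvPolynomial.X (Sum.inl (a, w))

lemma evalAt_comp_genericRow (g : GL Weight R) (a : Weight) :
    (evalAt g : RegFun Weight →+* R) ∘ genericRow a = g.1 a := by
  funext w
  simp [genericRow, evalAt, coords]

lemma evalAt_comp_single (g : GL Weight R) (a : Weight) :
    (evalAt g : RegFun Weight →+* R) ∘ (Pi.single a 1 : Weight → RegFun Weight) =
      Pi.single a 1 := by
  funext w
  by_cases h : w = a
  · subst h; simp
  · simp [h]

lemma evalAt_genericRow_dotProduct (g : GL Weight R) (w : Weight) (v : Weight → RegFun Weight) :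
    evalAt g (genericRow w ⬝ᵥ v) = (g.1 *ᵥ ((evalAt g : RegFun Weight →+* R) ∘ v)) w := by
  rw [Matrix.mulVec, ← evalAt_comp_genericRow]
  exact RingHom.map_dotProduct (evalAt g : RegFun Weight →+* R) _ _

lemma evalAt_normForm (g : GL Weight R) (a : Weight) :
    evalAt g (normForm (genericRow a) - normForm (Pi.single a 1)) =
      normForm (g.1 a) - normForm (Pi.single a 1) := by
  rw [map_sub, ← evalAt_comp_genericRow, ← evalAt_comp_single g, normForm_comp, normForm_comp]
  rfl

lemma evalAt_polar (g : GL Weight R) (a w : Weight) :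
    evalAt g (genericRow w ⬝ᵥ polar (genericRow a) - polar (Pi.single a 1) w) =
      (g.1 *ᵥ polar (g.1 a)) w - polar (Pi.single a 1) w := by
  rw [map_sub, evalAt_genericRow_dotProduct, ← polar_comp, evalAt_comp_genericRow,
    ← evalAt_comp_single g, polar_comp]
  rfl

lemma evalAt_cross (g : GL Weight R) (a b w : Weight) :
    evalAt g (genericRow w ⬝ᵥ cross (genericRow a) (genericRow b) -
        cross (Pi.single a 1) (Pi.single b 1) w) =
      (g.1 *ᵥ cross (g.1 a) (g.1 b)) w - cross (Pi.single a 1) (Pi.single b 1) w := by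
  rw [map_sub, evalAt_genericRow_dotProduct, ← cross_comp, evalAt_comp_genericRow,
    evalAt_comp_genericRow, ← evalAt_comp_single g, ← evalAt_comp_single g, cross_comp]
  rfl

lemma normForm_of_mem_groupG2 {g : GL Weight R} (hg : g ∈ groupG2 R) (a : Weight) :
    normForm (g.1 a) = normForm (Pi.single a 1 : Weight → R) := by
  rw [← sub_eq_zero, ← evalAt_normForm]
  refine hg _ fun x hx => ?_
  have h := (elementaryGroup_le_isometryGroup hx).1 (Pi.single a 1)
  rw [Matrix.single_one_vecMul] at h
  rw [evalAt_normForm, sub_eq_zero]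
  exact h

lemma mulVec_polar_of_mem_groupG2 {g : GL Weight R} (hg : g ∈ groupG2 R) (a : Weight) :
    g.1 *ᵥ polar (g.1 a) = polar (Pi.single a 1 : Weight → R) := by
  funext w
  rw [← sub_eq_zero, ← evalAt_polar]
  refine hg _ fun x hx => ?_
  have h := (elementaryGroup_le_isometryGroup hx).2.1 (Pi.single a 1)
  rw [Matrix.single_one_vecMul] at h
  rw [evalAt_polar, sub_eq_zero]
  exact congrFun h w

lemma mulVec_cross_of_mem_groupG2 {g : GL Weight R} (hg : g ∈ groupG2 R) (a b : Weight) :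
    g.1 *ᵥ cross (g.1 a) (g.1 b) = cross (Pi.single a 1 : Weight → R) (Pi.single b 1) := by
  funext w
  rw [← sub_eq_zero, ← evalAt_cross]
  refine hg _ fun x hx => ?_
  have h := (elementaryGroup_le_isometryGroup hx).2.2 (Pi.single a 1) (Pi.single b 1)
  rw [Matrix.single_one_vecMul, Matrix.single_one_vecMul] at h
  rw [evalAt_cross, sub_eq_zero]
  exact congrFun h w

/-! ## The stabilizer of a pair of opposite weight rows -/

lemma single_pos_eq_row (k : Fin 3) : (Pi.single (.pos k) 1 : Weight → R) = row k 1 0 0 0 0 0 0 := by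
  funext w
  rcases w with l | l | l <;> fin_cases k <;> fin_cases l <;> simp [row]

lemma single_neg_eq_row (k : Fin 3) : (Pi.single (.neg k) 1 : Weight → R) = row k 0 0 0 1 0 0 0 := by
  funext w
  rcases w with l | l | l <;> fin_cases k <;> fin_cases l <;> simp [row]

lemma single_zero_eq_row (k : Fin 3) : (Pi.single .zero 1 : Weight → R) = row k 0 0 0 0 0 0 1 := by
  funext w
  rcases w with l | l | l <;> fin_cases k <;> fin_cases l <;> simp [row]

lemma mulVec_row (A : Matrix Weight Weight R) (k : Fin 3) (a b c a' b' c' z : R) (w : Weight) :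
    (A *ᵥ row k a b c a' b' c' z) w = A w (.pos k) * a + A w (.pos (k + 1)) * b
      + A w (.pos (k + 2)) * c + (A w (.neg k) * a' + A w (.neg (k + 1)) * b'
      + A w (.neg (k + 2)) * c') + A w .zero * z := by
  rw [mulVec_weight]
  fin_cases k <;> simp [row] <;> ring

lemma row_inj {k : Fin 3} {a b c a' b' c' z d e f d' e' f' t : R} :
    row k a b c a' b' c' z = row k d e f d' e' f' t ↔
      a = d ∧ b = e ∧ c = f ∧ a' = d' ∧ b' = e' ∧ c' = f' ∧ z = t := by
  constructor
  · intro h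
    have h1 := congrFun h
    have h2 := h1 (.pos k)
    have h3 := h1 (.pos (k + 1))
    have h4 := h1 (.pos (k + 2))
    have h5 := h1 (.neg k)
    have h6 := h1 (.neg (k + 1))
    have h7 := h1 (.neg (k + 2))
    have h8 := h1 .zero
    clear h h1
    fin_cases k <;> simp_all [row]
  · rintro ⟨rfl, rfl, rfl, rfl, rfl, rfl, rfl⟩
    rfl

lemma mulVec_injective (g : GL Weight R) {u v : Weight → R} (h : g.1 *ᵥ u = g.1 *ᵥ v) : u = v := by
  have hl : (g⁻¹ : GL Weight R).1 * g.1 = 1 := g.inv_mul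
  rw [← Matrix.one_mulVec u, ← hl, ← Matrix.mulVec_mulVec, h, Matrix.mulVec_mulVec, hl,
    Matrix.one_mulVec]

lemma cross_basis_pos (k : Fin 3) (a b c a' b' c' z : R) :
    cross (row k 1 0 0 0 0 0 0) (row k a b c a' b' c' z) = row k 0 (-c) b (-z) 0 0 a' := by
  rw [cross_row]
  congr 1 <;> ring

lemma cross_basis_neg (k : Fin 3) (a b c a' b' c' z : R) :
    cross (row k 0 0 0 1 0 0 0) (row k a b c a' b' c' z) = row k z 0 0 0 (-c') b' (-a) := by
  rw [cross_row]
  congr 1 <;> ring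

section Stabilizer

variable {g : GL Weight R} {k : Fin 3}

lemma apply_neg_of_row_pos (hg : g ∈ groupG2 R) (h : g.1 (.pos k) = row k 1 0 0 0 0 0 0)
    (w : Weight) : g.1 w (.neg k) = (Pi.single (.neg k) 1 : Weight → R) w := by
  have h1 := congrFun (mulVec_polar_of_mem_groupG2 hg (.pos k)) w
  rw [h, polar_row, mulVec_row, single_pos_eq_row, polar_row] at h1
  have h2 : row k (-0 : R) (-0) (-0) (-1) (-0) (-0) (2 * 0) = -row k 0 0 0 1 0 0 0 := by
    funext w
    rcases w with l | l | l <;> fin_cases k <;> fin_cases l <;> simp [row]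
  rw [h2] at h1
  rw [single_neg_eq_row]
  simp only [Pi.neg_apply] at h1
  linear_combination -h1

lemma apply_pos_of_row_neg (hg : g ∈ groupG2 R) (h : g.1 (.neg k) = row k 0 0 0 1 0 0 0)
    (w : Weight) : g.1 w (.pos k) = (Pi.single (.pos k) 1 : Weight → R) w := by
  have h1 := congrFun (mulVec_polar_of_mem_groupG2 hg (.neg k)) w
  rw [h, polar_row, mulVec_row, single_neg_eq_row, polar_row] at h1
  have h2 : row k (-1 : R) (-0) (-0) (-0) (-0) (-0) (2 * 0) = -row k 1 0 0 0 0 0 0 := by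
    funext w
    rcases w with l | l | l <;> fin_cases k <;> fin_cases l <;> simp [row]
  rw [h2] at h1
  rw [single_pos_eq_row]
  simp only [Pi.neg_apply] at h1
  linear_combination -h1

lemma apply_zero_of_rows (hg : g ∈ groupG2 R) (h : g.1 (.pos k) = row k 1 0 0 0 0 0 0)
    (h' : g.1 (.neg k) = row k 0 0 0 1 0 0 0) (w : Weight) :
    g.1 w .zero = (Pi.single .zero 1 : Weight → R) w := by
  have h1 := congrFun (mulVec_cross_of_mem_groupG2 hg (.pos k) (.neg k)) w
  rw [h, h', single_pos_eq_row, single_neg_eq_row, cross_basis_pos, neg_zero,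
    mulVec_row] at h1
  rw [single_zero_eq_row k]
  linear_combination h1

/-- A row of `g` has no coordinates at `ε_{k+1}` and `ε_{k+2}` if the cross product of the
corresponding basis row with the basis row of `ε_k` is supported at `-ε_k`. -/
lemma apply_pos_eq_zero (hg : g ∈ groupG2 R) (h : g.1 (.pos k) = row k 1 0 0 0 0 0 0) (w : Weight)
    (t : R) (hw : cross (row k 1 0 0 0 0 0 0) (Pi.single w 1) = row k 0 0 0 t 0 0 0) :
    g.1 w (.pos (k + 1)) = 0 ∧ g.1 w (.pos (k + 2)) = 0 := by
  have h1 := mulVec_cross_of_mem_groupG2 hg (.pos k) w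
  have h2 : row k 0 0 0 t 0 0 0 = g.1 *ᵥ row k 0 0 0 t 0 0 0 := by
    funext v
    rw [mulVec_row, apply_neg_of_row_pos hg h, single_neg_eq_row]
    rcases v with l | l | l <;> fin_cases k <;> fin_cases l <;> simp [row]
  rw [h, single_pos_eq_row, hw, h2] at h1
  have h3 := mulVec_injective g h1
  rw [← row_eta k (g.1 w), cross_basis_pos, row_inj] at h3
  exact ⟨h3.2.2.1, neg_eq_zero.1 h3.2.1⟩

/-- A row of `g` has no coordinates at `-ε_{k+1}` and `-ε_{k+2}` if the cross product of the
corresponding basis row with the basis row of `-ε_k` is supported at `ε_k`. -/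
lemma apply_neg_eq_zero (hg : g ∈ groupG2 R) (h : g.1 (.neg k) = row k 0 0 0 1 0 0 0) (w : Weight)
    (t : R) (hw : cross (row k 0 0 0 1 0 0 0) (Pi.single w 1) = row k t 0 0 0 0 0 0) :
    g.1 w (.neg (k + 1)) = 0 ∧ g.1 w (.neg (k + 2)) = 0 := by
  have h1 := mulVec_cross_of_mem_groupG2 hg (.neg k) w
  have h2 : row k t 0 0 0 0 0 0 = g.1 *ᵥ row k t 0 0 0 0 0 0 := by
    funext v
    rw [mulVec_row, apply_pos_of_row_neg hg h, single_pos_eq_row]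
    rcases v with l | l | l <;> fin_cases k <;> fin_cases l <;> simp [row]
  rw [h, single_neg_eq_row, hw, h2] at h1
  have h3 := mulVec_injective g h1
  rw [← row_eta k (g.1 w), cross_basis_neg, row_inj] at h3
  exact ⟨h3.2.2.2.2.2.1, neg_eq_zero.1 h3.2.2.2.2.1⟩

end Stabilizer

lemma cross_basis_pos_single_neg {k l : Fin 3} (hl : l ≠ k) :
    cross (row k 1 0 0 0 0 0 0) (Pi.single (.neg l) 1 : Weight → R) = row k 0 0 0 0 0 0 0 := by
  rw [← row_eta k (Pi.single _ _), cross_basis_pos, row_inj]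
  fin_cases k <;> fin_cases l <;> first | exact absurd rfl hl | simp

lemma cross_basis_neg_single_pos {k l : Fin 3} (hl : l ≠ k) :
    cross (row k 0 0 0 1 0 0 0) (Pi.single (.pos l) 1 : Weight → R) = row k 0 0 0 0 0 0 0 := by
  rw [← row_eta k (Pi.single _ _), cross_basis_neg, row_inj]
  fin_cases k <;> fin_cases l <;> first | exact absurd rfl hl | simp

lemma cross_basis_pos_single_zero (k : Fin 3) :
    cross (row k 1 0 0 0 0 0 0) (Pi.single .zero 1 : Weight → R) = row k 0 0 0 (-1) 0 0 0 := by
  rw [single_zero_eq_row k, cross_basis_pos, neg_zero]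

lemma cross_basis_neg_single_zero (k : Fin 3) :
    cross (row k 0 0 0 1 0 0 0) (Pi.single .zero 1 : Weight → R) = row k 1 0 0 0 0 0 0 := by
  rw [single_zero_eq_row k, cross_basis_neg, neg_zero]

lemma eq_or_eq_add (k m : Fin 3) : m = k ∨ m = k + 1 ∨ m = k + 2 := by
  revert k m; decide

section Stabilizer

variable {g : GL Weight R} {k : Fin 3}

lemma apply_neg_pos (hg : g ∈ groupG2 R) (h : g.1 (.pos k) = row k 1 0 0 0 0 0 0)
    (h' : g.1 (.neg k) = row k 0 0 0 1 0 0 0) (l m : Fin 3) : g.1 (.neg l) (.pos m) = 0 := by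
  by_cases hl : l = k
  · rw [hl, h']
    fin_cases k <;> fin_cases m <;> simp [row]
  · rcases eq_or_eq_add k m with rfl | rfl | rfl
    · simp [apply_pos_of_row_neg hg h']
    · exact (apply_pos_eq_zero hg h _ _ (cross_basis_pos_single_neg hl)).1
    · exact (apply_pos_eq_zero hg h _ _ (cross_basis_pos_single_neg hl)).2

lemma apply_pos_neg (hg : g ∈ groupG2 R) (h : g.1 (.pos k) = row k 1 0 0 0 0 0 0)
    (h' : g.1 (.neg k) = row k 0 0 0 1 0 0 0) (l m : Fin 3) : g.1 (.pos l) (.neg m) = 0 := by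
  by_cases hl : l = k
  · rw [hl, h]
    fin_cases k <;> fin_cases m <;> simp [row]
  · rcases eq_or_eq_add k m with rfl | rfl | rfl
    · simp [apply_neg_of_row_pos hg h]
    · exact (apply_neg_eq_zero hg h' _ _ (cross_basis_neg_single_pos hl)).1
    · exact (apply_neg_eq_zero hg h' _ _ (cross_basis_neg_single_pos hl)).2

lemma apply_zero_pos (hg : g ∈ groupG2 R) (h : g.1 (.pos k) = row k 1 0 0 0 0 0 0)
    (h' : g.1 (.neg k) = row k 0 0 0 1 0 0 0) (m : Fin 3) : g.1 .zero (.pos m) = 0 := by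
  rcases eq_or_eq_add k m with rfl | rfl | rfl
  · simp [apply_pos_of_row_neg hg h']
  · exact (apply_pos_eq_zero hg h _ _ (cross_basis_pos_single_zero k)).1
  · exact (apply_pos_eq_zero hg h _ _ (cross_basis_pos_single_zero k)).2

lemma apply_zero_neg (hg : g ∈ groupG2 R) (h : g.1 (.pos k) = row k 1 0 0 0 0 0 0)
    (h' : g.1 (.neg k) = row k 0 0 0 1 0 0 0) (m : Fin 3) : g.1 .zero (.neg m) = 0 := by
  rcases eq_or_eq_add k m with rfl | rfl | rfl
  · simp [apply_neg_of_row_pos hg h]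
  · exact (apply_neg_eq_zero hg h' _ _ (cross_basis_neg_single_zero k)).1
  · exact (apply_neg_eq_zero hg h' _ _ (cross_basis_neg_single_zero k)).2

lemma minor_eq_one (hg : g ∈ groupG2 R) (h : g.1 (.pos k) = row k 1 0 0 0 0 0 0)
    (h' : g.1 (.neg k) = row k 0 0 0 1 0 0 0) :
    g.1 (.pos (k + 1)) (.pos (k + 1)) * g.1 (.pos (k + 2)) (.pos (k + 2)) -
      g.1 (.pos (k + 1)) (.pos (k + 2)) * g.1 (.pos (k + 2)) (.pos (k + 1)) = 1 := by
  have h1 := congrFun (mulVec_cross_of_mem_groupG2 hg (.pos k) (.pos (k + 1))) (.pos (k + 2))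
  have h2 : cross (row k 1 0 0 0 0 0 0) (Pi.single (.pos (k + 1)) 1 : Weight → R)
      (.pos (k + 2)) = 1 := by
    rw [single_pos_eq_row, ← row_rotate, cross_basis_pos]
    clear h h' h1
    fin_cases k <;> simp [row]
  rw [single_pos_eq_row k, h2, h, ← row_eta k (g.1 (.pos (k + 1))), cross_basis_pos, mulVec_row]
    at h1
  simp only [apply_pos_neg hg h h', apply_zero_of_rows hg h h', Pi.single_apply, reduceCtorEq,
    if_false] at h1
  linear_combination h1

/-- An element of the Chevalley group that fixes the basis rows of `± ε_k` lies in the long root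
subgroup `G(A_1, R)` orthogonal to `ε_k`. -/
lemma mem_groupA1_of_rows (hg : g ∈ groupG2 R) (h : g.1 (.pos k) = row k 1 0 0 0 0 0 0)
    (h' : g.1 (.neg k) = row k 0 0 0 1 0 0 0) {i j : Fin 3} (hij : i ≠ j) (hik : i ≠ k)
    (hjk : j ≠ k) : g ∈ groupA1 R i j hij := by
  let A : Matrix (Fin 3) (Fin 3) R := fun l m => g.1 (.pos l) (.pos m)
  let A₂ : Matrix (Fin 2) (Fin 2) R := !![A i i, A i j; A j i, A j j]
  have hrow : ∀ m, A k m = if m = k then 1 else 0 := fun m => by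
    change g.1 (.pos k) (.pos m) = _
    rw [h]
    clear h h'
    fin_cases k <;> fin_cases m <;> simp [row]
  have hcol : ∀ l, A l k = if l = k then 1 else 0 := fun l => by
    change g.1 (.pos l) (.pos k) = _
    simp [apply_pos_of_row_neg hg h', Pi.single_apply]
  have hA : A = blockMatrix i j A₂ := by
    have hc : ∀ l, l = i ∨ l = j ∨ l = k := by
      clear * - hij hik hjk
      revert i j k; decide
    ext l m
    simp only [blockMatrix, Matrix.add_apply, Matrix.single_apply, Matrix.one_apply, A₂,
      Matrix.of_apply, Matrix.cons_val', Matrix.cons_val_zero, Matrix.cons_val_one,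
      Matrix.cons_val_fin_one]
    rcases hc l with rfl | rfl | rfl <;> rcases hc m with rfl | rfl | rfl <;>
      simp [hrow, hcol, hij, hij.symm, hik, hik.symm, hjk, hjk.symm]
  have hdet : A₂.det = 1 := by
    have hm : A (k + 1) (k + 1) * A (k + 2) (k + 2) - A (k + 1) (k + 2) * A (k + 2) (k + 1) = 1 :=
      minor_eq_one hg h h'
    have hc : i = k + 1 ∧ j = k + 2 ∨ i = k + 2 ∧ j = k + 1 := by
      clear * - hij hik hjk
      revert i j k; decide
    rw [Matrix.det_fin_two_of]
    rcases hc with ⟨rfl, rfl⟩ | ⟨rfl, rfl⟩ <;> linear_combination hm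
  refine ⟨⟨A₂, hdet⟩, ?_⟩
  let s : Matrix.SpecialLinearGroup (Fin 3) R := embSL2 i j hij ⟨A₂, hdet⟩
  have hs : s.1 = A := hA.symm
  have hinv : A * (Matrix.of fun m l => g.1 (.neg l) (.neg m)) = 1 := by
    ext l m
    have h1 := congrFun (mulVec_polar_of_mem_groupG2 hg (.neg m)) (.pos l)
    rw [mulVec_weight] at h1
    simp only [polar, Sum.elim_inl, Sum.elim_inr, apply_pos_neg hg h h',
      apply_zero_of_rows hg h h', Pi.single_apply] at h1
    simp only [Matrix.mul_apply, Fin.sum_univ_three, Matrix.of_apply, Matrix.one_apply]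
    simp only [reduceCtorEq, Sum.inr.injEq, Sum.inl.injEq, if_false] at h1
    simp only [A]
    linear_combination -h1
  have hsinv : (s⁻¹).1 = Matrix.of fun m l => g.1 (.neg l) (.neg m) := by
    have h1 : (s⁻¹).1 * A = 1 := by
      rw [← hs, ← Matrix.SpecialLinearGroup.coe_mul, inv_mul_cancel,
        Matrix.SpecialLinearGroup.coe_one]
    exact left_inv_eq_right_inv h1 hinv
  apply Units.ext
  change embA2Matrix s = g.1
  change Matrix.fromBlocks s.1 0 0 (Matrix.fromBlocks (s⁻¹).1.transpose 0 0 1) = g.1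
  rw [hs, hsinv]
  ext w v
  rcases w with w | w | w <;> rcases v with v | v | v
  · rfl
  · exact (apply_pos_neg hg h h' w v).symm
  · simp [apply_zero_of_rows hg h h']
  · exact (apply_neg_pos hg h h' w v).symm
  · rfl
  · simp [apply_zero_of_rows hg h h']
  · exact (apply_zero_pos hg h h' v).symm
  · exact (apply_zero_neg hg h h' v).symm
  · simp [apply_zero_of_rows hg h h']

end Stabilizer

/-! ## The decomposition -/

lemma elementaryProducts_mul {L L' : ℕ} {e e' : GL Weight R} (h : e ∈ elementaryProducts R L)
    (h' : e' ∈ elementaryProducts R L') : e * e' ∈ elementaryProducts R (L + L') := by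
  obtain ⟨l, hl, hlr, rfl⟩ := h
  obtain ⟨l', hl', hlr', rfl⟩ := h'
  refine ⟨l ++ l', by rw [List.length_append]; omega, fun x hx => ?_, List.prod_append⟩
  rcases List.mem_append.1 hx with hx | hx
  exacts [hlr x hx, hlr' x hx]

lemma elementaryProducts_inv {L : ℕ} {e : GL Weight R} (h : e ∈ elementaryProducts R L) :
    e⁻¹ ∈ elementaryProducts R L := by
  obtain ⟨l, hl, hlr, rfl⟩ := h
  refine ⟨(l.map (·⁻¹)).reverse, by simpa using hl, fun x hx => ?_,
    (List.prod_inv_reverse l).symm⟩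
  simp only [List.mem_reverse, List.mem_map] at hx
  obtain ⟨y, hy, rfl⟩ := hx
  obtain ⟨α, ξ, rfl⟩ := hlr y hy
  refine ⟨α, -ξ, inv_eq_of_mul_eq_one_right (Units.ext ?_)⟩
  change rootMatrix α ξ * rootMatrix α (-ξ) = 1
  rw [rootMatrix_mul, add_neg_cancel, rootMatrix_zero]

lemma elementaryProducts_mono {L L' : ℕ} (h : L ≤ L') :
    elementaryProducts R L ⊆ elementaryProducts R L' := by
  rintro _ ⟨l, hl, hlr, rfl⟩
  exact ⟨l, hl.trans h, hlr, rfl⟩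

/-- Under `ASR_3`, every element of the Chevalley group is the product of an element of
`G(A_1, R)` and `18` root elements. -/
lemma exists_mul_eq_of_ASR (hR : ASR R 3) {i j : Fin 3} (hij : i ≠ j) {g : GL Weight R}
    (hg : g ∈ groupG2 R) :
    ∃ a ∈ groupA1 R i j hij, ∃ e ∈ elementaryProducts R 18, a * e = g := by
  obtain ⟨k, hik, hjk⟩ : ∃ k, i ≠ k ∧ j ≠ k := by
    clear * -
    revert i j; decide
  have hmul : ∀ (x y : GL Weight R) (w : Weight), (x * y).1 w = x.1 w ᵥ* y.1 := fun x y w => rfl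
  have hmax : ∀ M : Ideal R, M.IsMaximal → ¬ ∀ w, g.1 (.pos k) w ∈ M := by
    intro M hM h
    refine (Ideal.ne_top_iff_one M).1 hM.ne_top ?_
    have h1 : (g.1 * (g⁻¹ : GL Weight R).1) (.pos k) (.pos k) = 1 := by
      rw [← Units.val_mul, mul_inv_cancel]; simp
    rw [← h1, Matrix.mul_apply]
    exact M.sum_mem fun w _ => M.mul_mem_right _ (h w)
  have hnorm : normForm (g.1 (.pos k)) = 0 := by
    rw [normForm_of_mem_groupG2 hg, single_pos_eq_row, normForm_row]; ring
  obtain ⟨e, he, her, -⟩ := reach_basis hR k _ hnorm hmax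
  have hge : g * e ∈ groupG2 R := mul_mem hg (elementaryProducts_subset _ he)
  have hone : (g * e).1 (.neg k) (.neg k) = 1 := by
    rw [apply_neg_of_row_pos hge ((hmul ..).trans her)]; simp
  have hnorm' : normForm ((g * e).1 (.neg k)) = 0 := by
    rw [normForm_of_mem_groupG2 hge, single_neg_eq_row, normForm_row]; ring
  have hrow := row_eta k ((g * e).1 (.neg k))
  rw [hone] at hrow
  rw [← hrow] at hnorm'
  obtain ⟨f, hf, hfr, hfp⟩ := reach_basis_neg k _ _ _ _ _ _ hnorm'
  rw [hrow] at hfr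
  refine ⟨g * e * f, mem_groupA1_of_rows (mul_mem hge (elementaryProducts_subset _ hf)) ?_
    ((hmul ..).trans hfr) hij hik hjk, (e * f)⁻¹,
    elementaryProducts_inv (elementaryProducts_mul he hf), by group⟩
  rw [hmul, hmul, her, hfp]

end ChevalleyG2

end

theorem theorem4p1 {R : Type*} [CommRing R] (hR : ChevalleyG2.ASR R 3) :
    (∀ (i j : Fin 3) (hij : i ≠ j),
      (ChevalleyG2.groupG2 R : Set (Matrix.GeneralLinearGroup ChevalleyG2.Weight R)) =
        (ChevalleyG2.groupA1 R i j hij : Set (Matrix.GeneralLinearGroup ChevalleyG2.Weight R)) *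
          ChevalleyG2.elementaryProducts R 24) ∧
    (ChevalleyG2.groupG2 R : Set (Matrix.GeneralLinearGroup ChevalleyG2.Weight R)) =
      (ChevalleyG2.groupA2 R : Set (Matrix.GeneralLinearGroup ChevalleyG2.Weight R)) *
        ChevalleyG2.elementaryProducts R 24 := by
  have hsub : (ChevalleyG2.groupA2 R : Set (Matrix.GeneralLinearGroup ChevalleyG2.Weight R)) *
      ChevalleyG2.elementaryProducts R 24 ⊆ ChevalleyG2.groupG2 R := by
    rintro _ ⟨a, ha, e, he, rfl⟩
    exact mul_mem (ChevalleyG2.groupA2_le_groupG2 ha) (ChevalleyG2.elementaryProducts_subset _ he)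
  have hsup : ∀ (i j : Fin 3) (hij : i ≠ j),
      (ChevalleyG2.groupG2 R : Set (Matrix.GeneralLinearGroup ChevalleyG2.Weight R)) ⊆
        (ChevalleyG2.groupA1 R i j hij : Set (Matrix.GeneralLinearGroup ChevalleyG2.Weight R)) *
          ChevalleyG2.elementaryProducts R 24 := by
    intro i j hij g hg
    obtain ⟨a, ha, e, he, rfl⟩ := ChevalleyG2.exists_mul_eq_of_ASR hR hij hg
    exact ⟨a, ha, e, ChevalleyG2.elementaryProducts_mono (by norm_num) he, rfl⟩
  have hle : ∀ (i j : Fin 3) (hij : i ≠ j),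
      (ChevalleyG2.groupA1 R i j hij : Set (Matrix.GeneralLinearGroup ChevalleyG2.Weight R)) *
          ChevalleyG2.elementaryProducts R 24 ⊆
        (ChevalleyG2.groupA2 R : Set (Matrix.GeneralLinearGroup ChevalleyG2.Weight R)) *
          ChevalleyG2.elementaryProducts R 24 := fun i j hij =>
    Set.mul_subset_mul_right (ChevalleyG2.groupA1_le_groupA2 i j hij)
  exact ⟨fun i j hij => (hsup i j hij).antisymm ((hle i j hij).trans hsub),
    ((hsup 0 1 (by decide)).trans (hle 0 1 (by decide))).antisymm hsub⟩
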